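/- \textbf{Model.} A network is a connected $n$-vertex graph $G=(V,E)$ with real edge weights and a unique minimum spanning tree (MST) $T$. The vertices have pairwise distinct identity numbers in $\{0,\dots,N-1\}$, where $N\le n^c$ for a constant $c$. The vertices communicate in synchronous rounds. In every round each vertex may send one message over each incident edge, and a message consists of $O(\log n)$ bits and $O(1)$ weights of edges of $G$. At the beginning a vertex knows only $N$, the parameter $k$, its own identity number and the weights of its incident edges; it does not know the identities of its neighbours. Local computation is free. The running time is the worst-case number of rounds until all vertices have halted, and the message complexity is the worst-case total number of messages sent. An $(\alpha,\beta)$-MST forest is a collection of at most $\alpha$ vertex-disjoint connected subtrees of $T$ (called fragments) that together cover $V$, each of strong diameter at most $\beta$, i.e., any two vertices of a fragment are at distance at most $\beta$ inside the fragment (each edge counting $1$). An algorithm computes the forest if at the end every vertex knows which of its incident edges belong to it, and knows the identity of its fragment, which is the identity number of one vertex of the fragment (its root). $\log$ is the logarithm to base $2$, and $\log^* n$ is the number of times that $\log$ has to be applied to $n$ to reach a value at most $1$. \textbf{Theorem 3.} For every constant $c$ there is a deterministic algorithm in this model such that, for every integer parameter $k$ with $1\le k\le n/10$ and every such network, it computes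 an $(n/k,O(k))$-MST forest in $O(k\cdot\log^* n)$ rounds, using $O(|E|\cdot\log k+n\cdot\log k\cdot\log^* n)$ messages. Moreover, the forest is the result of at most $\lceil\log k\rceil+O(1)$ phases of the Controlled-GHS procedure, which starts from the forest of singletons. In phase $i=0,1,2,\dots$, every fragment of diameter at most $2^i$ that does not contain all vertices chooses a minimum weight outgoing edge (MWOE). In the graph on these fragments in which two of them are adjacent if the chosen edge of one leads to the other, a maximal matching is chosen. The two fragments of every matched pair merge along the chosen edge that connects them, and every unmatched fragment of diameter at most $2^i$ merges along its own chosen edge with the fragment at the other end of that edge. The constants in all $O(\cdot)$ depend only on $c$. -/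

import Mathlib

/-- The iterated logarithm `log* n`: how often `log₂` has to be applied to `n` to reach a value that
is at most `1`. Rounding the intermediate values up does not change this number, because `x ≤ 1` iff
`⌈x⌉ ≤ 1` and `⌈log₂ x⌉ = ⌈log₂ ⌈x⌉⌉`. -/
noncomputable def logStar (n : ℕ) : ℕ :=
  sInf {j : ℕ | (Nat.clog 2)^[j] n ≤ 1}

/-! ### Weighted networks and their minimum spanning trees -/

/-- A weighted network on the vertex set `V`: a graph with real edge weights (only the values of
`weight` on edges matter), pairwise distinct identity numbers, and at every vertex an arbitrary
numbering of the incident edges by ports. A vertex refers to an incident edge by its port, and does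
not know the identity at the other end. -/
structure Network (V : Type*) where
  graph : SimpleGraph V
  weight : Sym2 V → ℝ
  ident : V → ℕ
  ident_injective : Function.Injective ident
  deg : V → ℕ
  port : ∀ v, Fin (deg v) ≃ graph.neighborSet v

namespace Network

variable {V : Type*}

/-- `T` is a spanning tree of the network. -/
def IsSpanningTree (net : Network V) (T : SimpleGraph V) : Prop :=
  T ≤ net.graph ∧ T.IsTree

/-- The total weight of a subgraph. -/
noncomputable def totalWeight (net : Network V) (T : SimpleGraph V) : ℝ :=
  ∑ᶠ e ∈ T.edgeSet, net.weight e

/-- `T` is a minimum spanning tree of the network. -/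
def IsMST (net : Network V) (T : SimpleGraph V) : Prop :=
  net.IsSpanningTree T ∧ ∀ T', net.IsSpanningTree T' → net.totalWeight T ≤ net.totalWeight T'

/-- `T` is the unique minimum spanning tree of the network. -/
def IsUniqueMST (net : Network V) (T : SimpleGraph V) : Prop :=
  net.IsMST T ∧ ∀ T', net.IsMST T' → T' = T

end Network

/-! ### MST forests

A collection of vertex-disjoint connected subtrees of a tree `T` that cover all vertices is
represented by the graph `H ≤ T` on all vertices that is their union; the members of the collection
(the fragments) are the connected components of `H`. -/

section Forests

variable {V : Type*}

/-- The strong diameter of the fragment `F` of `H` is at most `d`. (A path of `H` between two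
vertices of `F` stays in `F`, so `H.dist` is the distance inside the fragment.) -/
def FragmentDiamLE (H : SimpleGraph V) (F : H.ConnectedComponent) (d : ℕ) : Prop :=
  ∀ u ∈ F.supp, ∀ v ∈ F.supp, H.dist u v ≤ d

/-- `H` is an `(α, β)`-MST forest with respect to the minimum spanning tree `T`: its fragments are
subtrees of `T`, there are at most `α` of them, and each has strong diameter at most `β`. -/
def IsMSTForest (T H : SimpleGraph V) (α : ℝ) (β : ℕ) : Prop :=
  H ≤ T ∧ (Nat.card H.ConnectedComponent : ℝ) ≤ α ∧
    ∀ F : H.ConnectedComponent, FragmentDiamLE H F β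

end Forests

/-! ### The phases of the Controlled-GHS procedure -/

namespace Network

variable {V : Type*}

/-- `(u, v)` is an edge that leaves the fragment `F`, with `u` in `F` and `v` outside. -/
def IsOutgoing (net : Network V) {H : SimpleGraph V} (F : H.ConnectedComponent) (u v : V) : Prop :=
  u ∈ F.supp ∧ v ∉ F.supp ∧ net.graph.Adj u v

/-- `(u, v)` is a minimum weight outgoing edge of the fragment `F`. -/
def IsMWOE (net : Network V) {H : SimpleGraph V} (F : H.ConnectedComponent) (u v : V) : Prop :=
  net.IsOutgoing F u v ∧
    ∀ u' v', net.IsOutgoing F u' v' → net.weight s(u, v) ≤ net.weight s(u', v')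

/-- The fragments that choose a minimum weight outgoing edge in phase `i`: those of diameter at most
`2 ^ i` (a fragment that contains all vertices has no outgoing edge and does nothing). -/
def IsActive (net : Network V) (i : ℕ) {H : SimpleGraph V} (F : H.ConnectedComponent) : Prop :=
  FragmentDiamLE H F (2 ^ i) ∧ ∃ u v, net.IsOutgoing F u v

/-- The candidate fragment graph of phase `i`. If the edge that the fragment `F` chooses ends at the
vertex `dst F`, then two active fragments are adjacent when the edge of one leads to the other. -/
def candidateGraph (net : Network V) (i : ℕ) (H : SimpleGraph V) (dst : H.ConnectedComponent → V) :
    SimpleGraph H.ConnectedComponent where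
  Adj F F' := F ≠ F' ∧ net.IsActive i F ∧ net.IsActive i F' ∧
    (dst F ∈ F'.supp ∨ dst F' ∈ F.supp)
  symm := ⟨fun _ _ h => ⟨h.1.symm, h.2.2.1, h.2.1, h.2.2.2.symm⟩⟩
  loopless := ⟨fun _ h => h.1 rfl⟩

/-- `H'` arises from `H` by phase `i`: every active fragment `F` chooses a minimum weight outgoing
edge `(src F, dst F)`; a maximal matching `M` of the candidate fragment graph is chosen; the two
fragments of every matched pair merge along the chosen edge that connects them, and every unmatched
active fragment merges along its own chosen edge with the fragment at the other end. -/
def IsPhase (net : Network V) (i : ℕ) (H H' : SimpleGraph V) : Prop :=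
  ∃ (src dst : H.ConnectedComponent → V) (M : (net.candidateGraph i H dst).Subgraph),
    (∀ F, net.IsActive i F → net.IsMWOE F (src F) (dst F)) ∧
    M.IsMatching ∧
    (∀ F F', (net.candidateGraph i H dst).Adj F F' → F ∈ M.verts ∨ F' ∈ M.verts) ∧
    ∀ x y, H'.Adj x y ↔ H.Adj x y ∨
      ∃ F, net.IsActive i F ∧ (F ∉ M.verts ∨ M.Adj F (H.connectedComponentMk (dst F))) ∧
        s(x, y) = s(src F, dst F)

/-- `H` is the result of the phases `0, 1, …, t - 1`, started from the forest of singletons. -/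
def IsPhaseResult (net : Network V) (t : ℕ) (H : SimpleGraph V) : Prop :=
  ∃ Hs : ℕ → SimpleGraph V, Hs 0 = ⊥ ∧ (∀ i < t, net.IsPhase i (Hs i) (Hs (i + 1))) ∧ Hs t = H

end Network

/-! ### The synchronous CONGEST model -/

/-- A message: some natural numbers (identity numbers, counters, colours, …) and some edge
weights. -/
structure Message where
  nums : List ℕ
  weights : List ℝ

/-- The number of bits of the numerical part of a message; a list of numbers can be written
down in a self-delimiting way with at most twice as many bits. -/
def Message.bits (m : Message) : ℕ :=
  (m.nums.map fun x => Nat.size x + 1).sum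

/-- What a vertex with `d` ports returns: which of its incident edges belong to the forest, and the
identity of its fragment. -/
structure LocalResult (d : ℕ) where
  inForest : Fin d → Bool
  fragmentId : ℕ

/-- A deterministic synchronous algorithm for the construction of a forest. The state of a vertex
depends at first on its initial knowledge only: the size `N` of the identity space, the
parameter `k`, its own identity number, and the weights of its incident edges (by ports). In every
round a vertex sends at most one message through each port and updates its state with the messages
that it receives. A vertex whose state has a result has halted. -/
structure Protocol where
  State : ℕ → Type
  init : ∀ {d : ℕ}, (N k ident : ℕ) → (Fin d → ℝ) → State d
  send : ∀ {d : ℕ}, State d → Fin d → Option Message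
  receive : ∀ {d : ℕ}, State d → (Fin d → Option Message) → State d
  result : ∀ {d : ℕ}, State d → Option (LocalResult d)

namespace Protocol

variable {V : Type*}

/-- What a vertex in state `s` sends: after halting it sends nothing. -/
def outbox (P : Protocol) {d : ℕ} (s : P.State d) (i : Fin d) : Option Message :=
  if (P.result s).isSome then none else P.send s i

/-- What `v` receives, by ports, if the states of the vertices are given by `st`. -/
def inbox (P : Protocol) (net : Network V) (st : ∀ v, P.State (net.deg v)) (v : V)
    (i : Fin (net.deg v)) : Option Message :=
  P.outbox (st (net.port v i)) ((net.port (net.port v i)).symm ⟨v, (net.port v i).2.symm⟩)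

/-- The states of the vertices after `r` rounds. A vertex that has halted keeps its state. -/
def run (P : Protocol) (net : Network V) (N k : ℕ) : ℕ → ∀ v, P.State (net.deg v)
  | 0, v => P.init N k (net.ident v) fun i => net.weight s(v, net.port v i)
  | r + 1, v =>
    if (P.result (P.run net N k r v)).isSome then P.run net N k r v
    else P.receive (P.run net N k r v) (P.inbox net (P.run net N k r) v)

/-- What `v` sends through port `i` in round `r` (rounds are numbered from `0`). -/
def sent (P : Protocol) (net : Network V) (N k r : ℕ) (v : V) (i : Fin (net.deg v)) :
    Option Message :=
  P.outbox (P.run net N k r v) i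

/-- All vertices have halted after `R` rounds. -/
def HaltsWithin (P : Protocol) (net : Network V) (N k R : ℕ) : Prop :=
  ∀ v, (P.result (P.run net N k R v)).isSome

/-- The number of messages that are sent in the first `R` rounds. -/
def messageCount [Fintype V] (P : Protocol) (net : Network V) (N k R : ℕ) : ℕ :=
  ∑ r ∈ Finset.range R, ∑ v, ∑ i, if (P.sent net N k r v i).isSome then 1 else 0

/-- Every message consists of at most `B` bits and at most `W` weights of edges of the network. -/
def HasBandwidth (P : Protocol) (net : Network V) (N k : ℕ) (B : ℝ) (W : ℕ) : Prop :=
  ∀ r v i m, P.sent net N k r v i = some m →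
    (m.bits : ℝ) ≤ B ∧ m.weights.length ≤ W ∧
      ∀ x ∈ m.weights, ∃ e ∈ net.graph.edgeSet, net.weight e = x

/-- After `R` rounds, the results of the vertices describe the forest `H`: every vertex knows which
of its incident edges belong to `H`, and every fragment has a root, whose identity number is known
to all vertices of the fragment as the identity of the fragment. -/
def Computes (P : Protocol) (net : Network V) (N k R : ℕ) (H : SimpleGraph V) : Prop :=
  ∃ res : ∀ v, LocalResult (net.deg v),
    (∀ v, P.result (P.run net N k R v) = some (res v)) ∧
    (∀ v i, (res v).inForest i = true ↔ H.Adj v (net.port v i)) ∧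
    ∀ F : H.ConnectedComponent, ∃ rt ∈ F.supp, ∀ v ∈ F.supp, (res v).fragmentId = net.ident rt

end Protocol

/-!
All vertices follow a common schedule of rounds, computed from `N` and `k`, which runs
`⌈log k⌉ + 1` phases of Controlled-GHS and sends nothing if `k = 1`.

*Why the forest is right.* With a unique minimum spanning tree `T`, every minimum weight outgoing edge
lies in `T` (`Network.IsUniqueMST.adj_of_isMWOE`), so all forests are subgraphs of `T`. The fragments
that merge in phase `i` form a hub, namely a matched pair or an inactive fragment, with active
fragments of diameter at most `2 ^ i` attached to it; hence the diameter stays below `6 * 2 ^ i`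
(`Network.IsPhase.diam`). A fragment that does not merge has a diameter above `2 ^ i` or contains all
vertices, so after phase `i` all fragments have at least `2 ^ i` vertices or are everything
(`Network.IsPhase.size`). This gives at most `n / k` fragments of diameter `O(k)`.

*How a fragment computes.* The only tool inside a fragment is an aggregation: a vertex sends a message
to a neighbour in the fragment as soon as all its other neighbours in the fragment have reported. The
fragment is a tree, so the message from `v` to `u` is sent exactly in the round whose number is the
height of the side of `v`, every tree edge carries one message in each direction, and a vertex hears
from all its neighbours within `r` rounds if and only if the whole fragment is within distance `r`
(`Aggregation.runs_steps`). So an aggregation costs at most `2 * n` messages and as many rounds as the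
diameter bound, and it also measures the diameter of the fragments.

*How a phase is computed.* The fragments agree on identities and on their chosen edges
(`Network.runs_select`). The identities are a colouring of the fragments that is proper along the
chosen edges, and `log* N` steps of deterministic coin tossing reduce it to eight colours
(`Network.runs_tossCoins`); no step needs more than the colour of the fragment to which the own chosen
edge leads. Then, for one colour after the other, the unmatched active fragments of this colour propose
along their chosen edges, and every unmatched active fragment accepts one proposal
(`Network.runs_propose`, `IsGreedyMatching.step`). Every candidate edge is the chosen edge of one of its
ends, so the resulting matching is maximal.

*Complexity.* Phase `i` takes `O(2 ^ i * log* N)` rounds, a geometric sum, and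
`O(|E| + n * log* N)` messages, and `log* N ≤ log* n + O(1)` because `N ≤ n ^ c` (`logStar_le_add`).

The correctness of the schedule is a chain of statements `Network.Runs`, each of which says where a list
of rounds leads from a given configuration, with how many and which messages.
-/

/-! ### Branches of a forest -/

section Branches

variable {V : Type*} {H : SimpleGraph V}

/-- The vertices that lie on the side of `v` of the edge between `v` and its neighbour `u`: those
that are closer to `v` than to `u`. -/
def branch (H : SimpleGraph V) (v u : V) : Set V :=
  {x | H.Reachable v x ∧ H.dist u x = H.dist v x + 1}

theorem self_mem_branch {v u : V} (h : H.Adj u v) : v ∈ branch H v u := by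
  refine ⟨SimpleGraph.Reachable.refl v, ?_⟩
  rw [SimpleGraph.dist_self, zero_add, SimpleGraph.dist_eq_one_iff_adj]
  exact h

theorem exists_adj_dist_eq {v x : V} (hr : H.Reachable v x) (hne : v ≠ x) :
    ∃ w, H.Adj v w ∧ x ∈ branch H w v := by
  obtain ⟨p, hp⟩ := hr.exists_walk_length_eq_dist
  cases p with
  | nil => exact absurd rfl hne
  | @cons _ w _ hadj q =>
    refine ⟨w, hadj, q.reachable, le_antisymm ?_ ?_⟩
    · obtain ⟨q', hq'⟩ := q.reachable.exists_walk_length_eq_dist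
      have := SimpleGraph.dist_le (SimpleGraph.Walk.cons hadj q')
      rw [SimpleGraph.Walk.length_cons] at this
      omega
    · have := SimpleGraph.dist_le q
      rw [SimpleGraph.Walk.length_cons] at hp
      omega

/-- In a forest only one neighbour of `v` is closer to `x` than `v` is. -/
theorem eq_of_mem_branch (hH : H.IsAcyclic) {v u w x : V} (hu : H.Adj v u) (hw : H.Adj v w)
    (hxu : x ∈ branch H u v) (hxw : x ∈ branch H w v) : u = w := by
  have key : ∀ u, H.Adj v u → x ∈ branch H u v →
      ∃ p : H.Path v x, p.1.snd = u := by
    intro u hu hx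
    obtain ⟨p, hp⟩ := hx.1.exists_walk_length_eq_dist
    refine ⟨⟨SimpleGraph.Walk.cons hu p, ?_⟩, by simp⟩
    apply SimpleGraph.Walk.isPath_of_length_eq_dist
    rw [SimpleGraph.Walk.length_cons, hp, hx.2]
  obtain ⟨p, hp⟩ := key u hu hxu
  obtain ⟨q, hq⟩ := key w hw hxw
  rw [← hp, ← hq, (hH.subsingleton_path v x).elim p q]

theorem mem_branch_iff (hH : H.IsAcyclic) {v u x : V} (h : H.Adj v u) :
    x ∈ branch H v u ↔ x = v ∨ ∃ w, H.Adj v w ∧ w ≠ u ∧ x ∈ branch H w v := by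
  constructor
  · intro hx
    by_cases hxv : x = v
    · exact Or.inl hxv
    · obtain ⟨w, hw, hxw⟩ := exists_adj_dist_eq hx.1 (Ne.symm hxv)
      refine Or.inr ⟨w, hw, ?_, hxw⟩
      rintro rfl
      have h1 := hx.2
      have h2 := hxw.2
      omega
  · rintro (rfl | ⟨w, hw, hne, hx⟩)
    · exact self_mem_branch h.symm
    · have hr : H.Reachable v x := hw.reachable.trans hx.1
      refine ⟨hr, ?_⟩
      rcases hH.dist_eq_dist_add_one_of_adj_of_reachable x h hr.symm with h1 | h1
      · refine absurd (eq_of_mem_branch hH hw h hx ⟨h.symm.reachable.trans hr, ?_⟩) hne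
        rw [H.dist_comm, h1, H.dist_comm]
      · rw [H.dist_comm, h1, H.dist_comm]

theorem reachable_iff_branch {v x : V} :
    H.Reachable v x ↔ x = v ∨ ∃ w, H.Adj v w ∧ x ∈ branch H w v := by
  constructor
  · intro hx
    by_cases hxv : x = v
    · exact Or.inl hxv
    · exact Or.inr (exists_adj_dist_eq hx (Ne.symm hxv))
  · rintro (rfl | ⟨w, hw, hx⟩)
    · exact SimpleGraph.Reachable.refl _
    · exact hw.reachable.trans hx.1

end Branches

/-! ### Minimum weight outgoing edges belong to the minimum spanning tree -/

theorem edgeSet_edge_eq {V : Type*} {u v : V} (h : u ≠ v) :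
    (SimpleGraph.edge u v).edgeSet = {s(u, v)} := by
  rw [SimpleGraph.edgeSet_edge]
  ext e
  simp only [Set.mem_sdiff, Set.mem_singleton_iff]
  constructor
  · exact fun h => h.1
  · rintro rfl
    exact ⟨rfl, by simpa using h⟩

namespace Network

variable {V : Type*} [Finite V]

/-- Exchanging an edge `f` of the tree path between `u` and `v` for the edge `uv` yields a
spanning tree again. -/
theorem isTree_exchange {T : SimpleGraph V} (hT : T.IsTree) {u v : V} (huv : u ≠ v)
    (hnadj : ¬ T.Adj u v) {p : T.Walk u v} (hp : p.IsPath) {x y : V} (hf : s(x, y) ∈ p.edges) :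
    ((T ⊔ SimpleGraph.edge u v).deleteEdges {s(x, y)}).IsTree := by
  have hle : T ≤ T ⊔ SimpleGraph.edge u v := le_sup_left
  have hadj : (T ⊔ SimpleGraph.edge u v).Adj v u :=
    Or.inr (by rw [SimpleGraph.edge_adj]; exact ⟨Or.inr ⟨rfl, rfl⟩, huv.symm⟩)
  have hfT : s(x, y) ∈ T.edgeSet := p.edges_subset_edgeSet hf
  have heT : s(u, v) ∉ T.edgeSet := hnadj
  have hcyc : (SimpleGraph.Walk.cons hadj (p.mapLe hle)).IsCycle := by
    rw [SimpleGraph.Walk.cons_isCycle_iff]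
    refine ⟨hp.mapLe hle, fun h => hnadj ?_⟩
    rw [SimpleGraph.Walk.edges_mapLe_eq_edges] at h
    exact (p.adj_of_mem_edges h).symm
  have hbr : ¬ (T ⊔ SimpleGraph.edge u v).IsBridge s(x, y) := by
    intro hb
    refine hb.notMem_edges_of_isCycle hcyc ?_
    rw [SimpleGraph.Walk.edges_cons, SimpleGraph.Walk.edges_mapLe_eq_edges]
    exact List.mem_cons_of_mem _ hf
  rw [SimpleGraph.isTree_iff_connected_and_card]
  refine ⟨(hT.connected.mono hle).connected_delete_edge_of_not_isBridge hbr, ?_⟩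
  rw [← (SimpleGraph.isTree_iff_connected_and_card.1 hT).2, SimpleGraph.edgeSet_deleteEdges,
    SimpleGraph.edgeSet_sup, edgeSet_edge_eq huv, Nat.card_coe_set_eq,
    Nat.card_coe_set_eq, Set.union_singleton, Set.ncard_sdiff_singleton_of_mem
    (Set.mem_insert_of_mem _ hfT), Set.ncard_insert_of_notMem heT]
  simp

/-- With a unique minimum spanning tree, every minimum weight outgoing edge of a set of vertices
belongs to it, even when several edges have the same weight: otherwise it could replace an edge of
the tree that leaves the same set and is at least as heavy. -/
theorem IsUniqueMST.adj_of_isMWOE {net : Network V} {T H : SimpleGraph V}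
    (hT : net.IsUniqueMST T) {F : H.ConnectedComponent} {u v : V} (h : net.IsMWOE F u v) :
    T.Adj u v := by
  classical
  by_contra hnadj
  obtain ⟨⟨hu, hv, hG⟩, hmin⟩ := h
  have htree := hT.1.1.2
  obtain ⟨p, hp⟩ := htree.connected.exists_isPath u v
  obtain ⟨d, hd, hd1, hd2⟩ := p.exists_boundary_dart F.supp hu hv
  have hf : s(d.fst, d.snd) ∈ p.edges := List.mem_map.2 ⟨d, hd, rfl⟩
  have hfT : s(d.fst, d.snd) ∈ T.edgeSet := p.edges_subset_edgeSet hf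
  have heT : s(u, v) ∉ T.edgeSet := hnadj
  have hw := hmin d.fst d.snd ⟨hd1, hd2, hT.1.1.1 d.adj⟩
  set T' := (T ⊔ SimpleGraph.edge u v).deleteEdges {s(d.fst, d.snd)} with hT'
  have hne : s(u, v) ≠ s(d.fst, d.snd) := fun h => heT (h ▸ hfT)
  have hE : T'.edgeSet = insert s(u, v) T.edgeSet \ {s(d.fst, d.snd)} := by
    rw [hT', SimpleGraph.edgeSet_deleteEdges, SimpleGraph.edgeSet_sup,
      edgeSet_edge_eq hG.ne, Set.union_singleton]
  have hspan : net.IsSpanningTree T' := by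
    refine ⟨fun a b hab => ?_, isTree_exchange htree hG.ne hnadj hp hf⟩
    have : s(a, b) ∈ insert s(u, v) T.edgeSet \ {s(d.fst, d.snd)} := hE ▸ hab
    rcases this.1 with h1 | h1
    · have : s(a, b) ∈ net.graph.edgeSet := h1 ▸ (show s(u, v) ∈ net.graph.edgeSet from hG)
      exact this
    · exact hT.1.1.1 h1
  have hfin : T.edgeSet.Finite := Set.toFinite _
  have h1 : ∑ᶠ e ∈ insert s(u, v) T.edgeSet, net.weight e
      = net.weight s(u, v) + net.totalWeight T :=
    finsum_mem_insert _ heT hfin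
  have h2 : ∑ᶠ e ∈ insert s(u, v) T.edgeSet, net.weight e
      = net.weight s(d.fst, d.snd) + net.totalWeight T' := by
    rw [totalWeight, hE, ← finsum_mem_insert _ (fun h => h.2 rfl) (Set.toFinite _),
      Set.insert_sdiff_singleton, Set.insert_eq_of_mem (Set.mem_insert_of_mem _ hfT)]
  have hMST : net.IsMST T' := by
    refine ⟨hspan, fun T'' h'' => le_trans ?_ (hT.1.2 T'' h'')⟩
    linarith
  have := hT.2 T' hMST
  apply heT
  rw [← this, hE]
  exact ⟨Set.mem_insert _ _, hne⟩

end Network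

/-! ### One phase of Controlled-GHS: subtrees, diameters and sizes -/

section Within

variable {V : Type*}

/-- `x` and `y` are joined by a walk of length at most `d`. -/
def Within (H : SimpleGraph V) (d : ℕ) (x y : V) : Prop :=
  ∃ p : H.Walk x y, p.length ≤ d

variable {H H' : SimpleGraph V} {d d' : ℕ} {x y z : V}

theorem Within.symm (h : Within H d x y) : Within H d y x :=
  ⟨h.choose.reverse, by rw [SimpleGraph.Walk.length_reverse]; exact h.choose_spec⟩

theorem Within.trans (h : Within H d x y) (h' : Within H d' y z) : Within H (d + d') x z :=
  ⟨h.choose.append h'.choose, by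
    rw [SimpleGraph.Walk.length_append]; exact add_le_add h.choose_spec h'.choose_spec⟩

theorem Within.mono (h : Within H d x y) (hH : H ≤ H') (hd : d ≤ d') : Within H' d' x y :=
  ⟨h.choose.mapLe hH, by
    rw [SimpleGraph.Walk.length_map]; exact h.choose_spec.trans hd⟩

theorem Within.of_adj (h : H.Adj x y) : Within H 1 x y := ⟨h.toWalk, le_of_eq rfl⟩

theorem FragmentDiamLE.within {F : H.ConnectedComponent} (h : FragmentDiamLE H F d)
    (hx : x ∈ F.supp) (hy : y ∈ F.supp) : Within H d x y := by
  obtain ⟨p, hp⟩ := (F.reachable_of_mem_supp hx hy).exists_walk_length_eq_dist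
  exact ⟨p, hp.le.trans (h x hx y hy)⟩

theorem FragmentDiamLE.mono {F : H.ConnectedComponent} (h : FragmentDiamLE H F d) (hd : d ≤ d') :
    FragmentDiamLE H F d' := fun u hu v hv => (h u hu v hv).trans hd

theorem Within.dist_le (h : Within H d x y) : H.dist x y ≤ d :=
  (SimpleGraph.dist_le h.choose).trans h.choose_spec

end Within

/-- Every fragment of `H` has at least `m` vertices, or contains all vertices. -/
def FragmentSizeGE {V : Type*} (H : SimpleGraph V) (m : ℕ) : Prop :=
  ∀ v, m ≤ {w | H.Reachable v w}.ncard ∨ ∀ w, H.Reachable v w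

namespace Network

variable {V : Type*} {net : Network V} {i : ℕ} {T H H' : SimpleGraph V}

theorem IsPhase.le (h : net.IsPhase i H H') : H ≤ H' := by
  obtain ⟨src, dst, M, -, -, -, hadj⟩ := h
  exact fun x y hxy => (hadj x y).2 (Or.inl hxy)

theorem IsPhase.le_tree [Finite V] (hT : net.IsUniqueMST T) (h : net.IsPhase i H H')
    (hHT : H ≤ T) : H' ≤ T := by
  obtain ⟨src, dst, M, hmw, -, -, hadj⟩ := h
  intro x y hxy
  rcases (hadj x y).1 hxy with h1 | ⟨F, hF, -, he⟩
  · exact hHT h1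
  · have h2 : s(src F, dst F) ∈ T.edgeSet := hT.adj_of_isMWOE (hmw F hF)
    rw [← he] at h2
    exact h2

/-- The fragments that a phase merges into one consist of a hub, which is an inactive fragment or
a matched pair, and of unmatched active fragments attached to the hub. -/
theorem IsPhase.diam (h : net.IsPhase i H H') {D : ℕ}
    (hD : ∀ F : H.ConnectedComponent, FragmentDiamLE H F D) (F' : H'.ConnectedComponent) :
    FragmentDiamLE H' F' (max D (2 * 2 ^ i + 1) + 2 * (2 ^ i + 1)) := by
  classical
  have hle := h.le
  obtain ⟨src, dst, M, hmw, hM, hmax, hadj⟩ := h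
  have hpartner : ∀ {A B C}, M.Adj A B → M.Adj A C → B = C := fun {A B C} hB hC =>
    (hM (M.edge_vert hB)).unique hB hC
  -- The hub of `A`, if `A` belongs to a hub.
  let K0 : H.ConnectedComponent → Set V :=
    fun A => {x | H.connectedComponentMk x = A ∨ M.Adj A (H.connectedComponentMk x)}
  let K : H.ConnectedComponent → Set V := fun A =>
    if net.IsActive i A ∧ A ∉ M.verts then K0 (H.connectedComponentMk (dst A)) else K0 A
  have hK0 : ∀ {A B}, M.Adj A B → K0 A = K0 B := by
    intro A B hAB
    ext x
    constructor
    · rintro (hx | hx)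
      · exact Or.inr (by rw [hx]; exact hAB.symm)
      · exact Or.inl (hpartner hx hAB)
    · rintro (hx | hx)
      · exact Or.inr (by rw [hx]; exact hAB)
      · exact Or.inl (hpartner hx hAB.symm)
  have hdst : ∀ A, net.IsActive i A → A ∉ M.verts →
      ¬ (net.IsActive i (H.connectedComponentMk (dst A)) ∧
        H.connectedComponentMk (dst A) ∉ M.verts) := by
    rintro A hA hAM ⟨hB, hBM⟩
    have hne : A ≠ H.connectedComponentMk (dst A) := fun he => (hmw A hA).1.2.1 he.symm
    rcases hmax A (H.connectedComponentMk (dst A)) ⟨hne, hA, hB, Or.inl rfl⟩ with h1 | h1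
    · exact hAM h1
    · exact hBM h1
  have hKadj : ∀ x y, H'.Adj x y →
      K (H.connectedComponentMk x) = K (H.connectedComponentMk y) := by
    have hedge : ∀ A, net.IsActive i A →
        (A ∉ M.verts ∨ M.Adj A (H.connectedComponentMk (dst A))) →
        K (H.connectedComponentMk (src A)) = K (H.connectedComponentMk (dst A)) := by
      intro A hA hAM
      have hs : H.connectedComponentMk (src A) = A := (hmw A hA).1.1
      rw [hs]
      by_cases hv : A ∈ M.verts
      · have hMA := hAM.resolve_left (fun h => h hv)
        simp only [K, hv, M.edge_vert hMA.symm, not_true, and_false, if_false]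
        exact hK0 hMA
      · simp only [K]
        rw [if_pos ⟨hA, hv⟩, if_neg (hdst A hA hv)]
    intro x y hxy
    rcases (hadj x y).1 hxy with h1 | ⟨A, hA, hAM, he⟩
    · rw [SimpleGraph.ConnectedComponent.sound h1.reachable]
    · rcases Sym2.eq_iff.1 he with ⟨rfl, rfl⟩ | ⟨rfl, rfl⟩
      · exact hedge A hA hAM
      · exact (hedge A hA hAM).symm
  have hKreach : ∀ x y, H'.Reachable x y →
      K (H.connectedComponentMk x) = K (H.connectedComponentMk y) := by
    rintro x y ⟨p⟩
    induction p with
    | nil => rfl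
    | cons hd _ ih => exact (hKadj _ _ hd).trans ih
  have hto : ∀ x, ∃ z ∈ K (H.connectedComponentMk x), Within H' (2 ^ i + 1) x z := by
    intro x
    by_cases hx : net.IsActive i (H.connectedComponentMk x) ∧ H.connectedComponentMk x ∉ M.verts
    · refine ⟨dst (H.connectedComponentMk x), ?_, ?_⟩
      · simp only [K]
        rw [if_pos hx]
        exact Or.inl rfl
      · refine ((hx.1.1.within rfl (hmw _ hx.1).1.1).mono hle le_rfl).trans (Within.of_adj ?_)
        exact (hadj _ _).2 (Or.inr ⟨_, hx.1, Or.inl hx.2, rfl⟩)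
    · refine ⟨x, ?_, SimpleGraph.Walk.nil, Nat.zero_le _⟩
      simp only [K]
      rw [if_neg hx]
      exact Or.inl rfl
  have hpair : ∀ {A B}, M.Adj A B → ∀ x ∈ A.supp, ∀ y ∈ B.supp,
      Within H' (2 * 2 ^ i + 1) x y := by
    have hone : ∀ A B, net.IsActive i A → net.IsActive i B → M.Adj A B → dst A ∈ B.supp →
        ∀ x ∈ A.supp, ∀ y ∈ B.supp, Within H' (2 * 2 ^ i + 1) x y := by
      intro A B hA hB hAB hd x hx y hy
      have he : H'.Adj (src A) (dst A) := by
        refine (hadj _ _).2 (Or.inr ⟨A, hA, Or.inr ?_, rfl⟩)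
        rw [show H.connectedComponentMk (dst A) = B from hd]
        exact hAB
      refine ((((hA.1.within hx (hmw A hA).1.1).mono hle le_rfl).trans (Within.of_adj he)).trans
        ((hB.1.within hd hy).mono hle le_rfl)).mono le_rfl (by omega)
    intro A B hAB x hx y hy
    obtain ⟨-, hA, hB, hd | hd⟩ := M.adj_sub hAB
    · exact hone A B hA hB hAB hd x hx y hy
    · exact (hone B A hB hA hAB.symm hd y hy x hx).symm
  have hK0within : ∀ A, ∀ x ∈ K0 A, ∀ y ∈ K0 A, Within H' (max D (2 * 2 ^ i + 1)) x y := by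
    rintro A x (hx | hx) y (hy | hy)
    · exact ((hD A).within hx hy).mono hle (le_max_left _ _)
    · exact (hpair hy x hx y rfl).mono le_rfl (le_max_right _ _)
    · exact (hpair hx y hy x rfl).symm.mono le_rfl (le_max_right _ _)
    · exact ((hD _).within rfl (hpartner hy hx)).mono hle (le_max_left _ _)
  intro x hx y hy
  have hxy := hKreach x y (F'.reachable_of_mem_supp hx hy)
  obtain ⟨a, ha, hxa⟩ := hto x
  obtain ⟨b, hb, hyb⟩ := hto y
  rw [← hxy] at hb
  have hab : Within H' (max D (2 * 2 ^ i + 1)) a b := by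
    simp only [K] at ha hb
    split_ifs at ha hb
    · exact hK0within _ a ha b hb
    · exact hK0within _ a ha b hb
  refine (((hxa.trans hab).trans hyb.symm).mono le_rfl (by omega)).dist_le

/-- A fragment that is not merged in phase `i` is large because its diameter is, or because it
contains all vertices. -/
theorem IsPhase.size [Finite V] (hnet : net.graph.Connected) (h : net.IsPhase i H H') {m : ℕ}
    (hm : 2 ^ i ≤ 2 * m) (hH : FragmentSizeGE H m) : FragmentSizeGE H' (2 ^ i) := by
  classical
  have hle := h.le
  obtain ⟨src, dst, M, hmw, hM, hmax, hadj⟩ := h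
  intro v
  have hsub : ∀ {x y}, H.Reachable x y → H'.Reachable x y := fun h => h.mono hle
  have hsuppset : ∀ x, {w | H.Reachable x w} = (H.connectedComponentMk x).supp := by
    intro x
    ext w
    simp only [Set.mem_ofPred_eq, SimpleGraph.ConnectedComponent.mem_supp_iff,
      SimpleGraph.ConnectedComponent.eq]
    exact SimpleGraph.reachable_comm
  by_cases hact : net.IsActive i (H.connectedComponentMk v)
  · -- The fragment of `v` merges with another fragment.
    have hmerge : ∃ x, H'.Reachable v x ∧ ¬ H.Reachable v x := by
      by_cases hv : H.connectedComponentMk v ∈ M.verts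
      · obtain ⟨B, hB, -⟩ := hM hv
        obtain ⟨hne, -, hBact, hd⟩ := M.adj_sub hB
        have key : ∀ A B, net.IsActive i A → M.Adj A B → dst A ∈ B.supp →
            H'.Adj (src A) (dst A) := by
          intro A B hA hAB hd
          refine (hadj _ _).2 (Or.inr ⟨A, hA, Or.inr ?_, rfl⟩)
          rw [show H.connectedComponentMk (dst A) = B from hd]
          exact hAB
        rcases hd with hd | hd
        · have h1 := (hmw _ hact).1
          have hs : H.connectedComponentMk (src (H.connectedComponentMk v)) = _ := h1.1
          refine ⟨_, (hsub (SimpleGraph.ConnectedComponent.exact hs.symm)).trans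
            (key _ _ hact hB hd).reachable, fun hr => h1.2.1 ?_⟩
          exact (SimpleGraph.ConnectedComponent.sound hr).symm
        · have h1 := (hmw _ hBact).1
          have hd' : H.connectedComponentMk (dst B) = _ := hd
          refine ⟨src B, (hsub (SimpleGraph.ConnectedComponent.exact hd'.symm)).trans
            (key _ _ hBact hB.symm hd).symm.reachable, fun hr => hne ?_⟩
          rw [SimpleGraph.ConnectedComponent.sound hr]
          exact h1.1
      · have h1 := (hmw _ hact).1
        have hs : H.connectedComponentMk (src (H.connectedComponentMk v)) = _ := h1.1
        refine ⟨_, (hsub (SimpleGraph.ConnectedComponent.exact hs.symm)).trans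
          (((hadj _ _).2 (Or.inr ⟨_, hact, Or.inl hv, rfl⟩)).reachable), fun hr => h1.2.1 ?_⟩
        exact (SimpleGraph.ConnectedComponent.sound hr).symm
    obtain ⟨x, hx, hnx⟩ := hmerge
    left
    have h1 : m ≤ {w | H.Reachable v w}.ncard := (hH v).resolve_right fun h => hnx (h x)
    have h2 : m ≤ {w | H.Reachable x w}.ncard := (hH x).resolve_right fun h => hnx (h v).symm
    have hdisj : Disjoint {w | H.Reachable v w} {w | H.Reachable x w} := by
      rw [Set.disjoint_left]
      exact fun w hw hw' => hnx (hw.trans hw'.symm)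
    have h3 := Set.ncard_union_eq hdisj (Set.toFinite _) (Set.toFinite _)
    have h4 : ({w | H.Reachable v w} ∪ {w | H.Reachable x w}).ncard
        ≤ {w | H'.Reachable v w}.ncard := by
      apply Set.ncard_le_ncard _ (Set.toFinite _)
      rintro w (hw | hw)
      · exact hsub hw
      · exact hx.trans (hsub hw)
    omega
  · by_cases hout : ∃ u w, net.IsOutgoing (H.connectedComponentMk v) u w
    · have hdiam : ¬ FragmentDiamLE H (H.connectedComponentMk v) (2 ^ i) :=
        fun h => hact ⟨h, hout⟩
      simp only [FragmentDiamLE, not_forall, not_le] at hdiam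
      obtain ⟨a, ha, b, hb, hab⟩ := hdiam
      left
      obtain ⟨p, hp, hlen⟩ :=
        (SimpleGraph.ConnectedComponent.reachable_of_mem_supp _ ha hb).exists_path_of_dist
      have h1 : (p.support.toFinset : Set V).ncard = p.length + 1 := by
        rw [Set.ncard_coe_finset, List.toFinset_card_of_nodup hp.support_nodup,
          SimpleGraph.Walk.length_support]
      have h2 : (p.support.toFinset : Set V).ncard ≤ {w | H'.Reachable v w}.ncard := by
        apply Set.ncard_le_ncard _ (Set.toFinite _)
        intro w hw
        have hw' : w ∈ p.support := by simpa using hw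
        refine hsub ((SimpleGraph.ConnectedComponent.exact ha).symm.trans ?_)
        exact (p.takeUntil w hw').reachable
      omega
    · right
      intro w
      apply hsub
      obtain ⟨p⟩ := hnet.preconnected v w
      by_contra hw
      obtain ⟨d, -, hd1, hd2⟩ := p.exists_boundary_dart {w | H.Reachable v w}
        (SimpleGraph.Reachable.refl v) hw
      rw [hsuppset] at hd1 hd2
      exact hout ⟨d.fst, d.snd, hd1, hd2, d.adj⟩

end Network

theorem mul_card_connectedComponent_le {V : Type*} [Fintype V] {H : SimpleGraph V} {k : ℕ}
    (h : FragmentSizeGE H k) (hk : k ≤ Fintype.card V) :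
    k * Nat.card H.ConnectedComponent ≤ Fintype.card V := by
  classical
  have : Fintype H.ConnectedComponent := Fintype.ofFinite _
  have hsum : Fintype.card V = ∑ F : H.ConnectedComponent,
      (Finset.univ.filter fun v => H.connectedComponentMk v = F).card :=
    Finset.card_eq_sum_card_fiberwise fun _ _ => Finset.mem_coe.2 (Finset.mem_univ _)
  rw [hsum, Nat.card_eq_fintype_card, mul_comm, ← smul_eq_mul, ← Finset.card_univ]
  refine Finset.card_nsmul_le_sum _ _ _ fun F _ => ?_
  induction F using SimpleGraph.ConnectedComponent.ind with | _ v
  have he : ((Finset.univ.filter fun w => H.connectedComponentMk w = H.connectedComponentMk v :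
      Finset V) : Set V) = {w | H.Reachable v w} := by
    ext w
    simp only [Finset.coe_filter, Finset.mem_univ, true_and, Set.mem_ofPred_eq,
      SimpleGraph.ConnectedComponent.eq]
    exact SimpleGraph.reachable_comm
  rw [← Set.ncard_coe_finset, he]
  rcases h v with h | h
  · exact h
  · rw [Set.eq_univ_of_forall (s := {w | H.Reachable v w}) h, Set.ncard_univ,
      Nat.card_eq_fintype_card]
    exact hk

/-! ### Deterministic coin tossing -/

section Coloring

/-- The new colour of a fragment with colour `c` whose chosen edge leads to a fragment with colour
`c'`: twice the index of the first bit in which the two differ, plus this bit of `c`. (The index is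
`0` if the colours are equal.) -/
noncomputable def recolor (c c' : ℕ) : ℕ :=
  2 * sInf {j | c.testBit j ≠ c'.testBit j} +
    (c.testBit (sInf {j | c.testBit j ≠ c'.testBit j})).toNat

/-- The new colour of a fragment that chooses no edge: it behaves as if the fragment at the other
end differed in bit `0`. -/
def recolorRoot (c : ℕ) : ℕ := (c.testBit 0).toNat

theorem bool_toNat_injective : Function.Injective Bool.toNat := by decide

theorem recolor_spec {a b : ℕ} (h : a ≠ b) :
    ∃ j, a.testBit j ≠ b.testBit j ∧ recolor a b = 2 * j + (a.testBit j).toNat := by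
  have hex : ∃ j, a.testBit j ≠ b.testBit j := by
    by_contra hcon
    push Not at hcon
    exact h (Nat.eq_of_testBit_eq hcon)
  exact ⟨_, Nat.sInf_mem (s := {j | a.testBit j ≠ b.testBit j}) hex, rfl⟩

theorem recolor_ne_recolor {a b c : ℕ} (hab : a ≠ b) (hbc : b ≠ c) :
    recolor a b ≠ recolor b c := by
  obtain ⟨j, hj, ej⟩ := recolor_spec hab
  obtain ⟨l, -, el⟩ := recolor_spec hbc
  intro he
  have h1 := Bool.toNat_lt (a.testBit j)
  have h2 := Bool.toNat_lt (b.testBit l)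
  have hjl : j = l := by omega
  subst hjl
  exact hj (bool_toNat_injective (by omega))

theorem recolor_ne_recolorRoot {a b : ℕ} (hab : a ≠ b) : recolor a b ≠ recolorRoot b := by
  obtain ⟨j, hj, ej⟩ := recolor_spec hab
  intro he
  have h2 := Bool.toNat_lt (b.testBit 0)
  unfold recolorRoot at he
  have hj0 : j = 0 := by omega
  subst hj0
  exact hj (bool_toNat_injective (by omega))

theorem recolor_lt {a b B : ℕ} (hB : 2 ≤ B) (ha : a < B) (hb : b < B) :
    recolor a b < 2 * Nat.clog 2 B := by
  have hpos : 0 < Nat.clog 2 B := Nat.clog_pos one_lt_two hB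
  have hpow := Nat.le_pow_clog one_lt_two B
  by_cases hab : a = b
  · subst hab
    have h1 := Bool.toNat_lt (a.testBit 0)
    simp only [recolor, ne_eq, not_true, Set.ofPred_false, Nat.sInf_empty]
    omega
  · obtain ⟨j, hj, ej⟩ := recolor_spec hab
    have hlt : j < Nat.clog 2 B := by
      by_contra hcon
      have hp : 2 ^ Nat.clog 2 B ≤ 2 ^ j := Nat.pow_le_pow_right two_pos (not_lt.1 hcon)
      apply hj
      rw [Nat.testBit_lt_two_pow (by omega), Nat.testBit_lt_two_pow (by omega)]
    have h1 := Bool.toNat_lt (a.testBit j)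
    omega

theorem recolorRoot_lt {a B : ℕ} (hB : 2 ≤ B) : recolorRoot a < 2 * Nat.clog 2 B := by
  have hpos : 0 < Nat.clog 2 B := Nat.clog_pos one_lt_two hB
  have h2 := Bool.toNat_lt (a.testBit 0)
  unfold recolorRoot
  omega

/-- An upper bound for the colours after `j` rounds of recolouring. -/
def colorBound (N j : ℕ) : ℕ := 4 * max ((Nat.clog 2)^[j] N) 2

/-- Recolouring turns colours below `B` into colours below `2 * clog₂ B`. The factor `4` and the
lower bound `2` make this compatible with the iteration of `clog₂` alone. -/
theorem two_mul_clog_colorBound_le (N j : ℕ) :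
    2 * Nat.clog 2 (colorBound N j) ≤ colorBound N (j + 1) := by
  unfold colorBound
  rw [Function.iterate_succ_apply']
  set y := (Nat.clog 2)^[j] N
  have h : Nat.clog 2 (4 * max y 2) ≤ 2 + max (Nat.clog 2 y) 1 := by
    apply Nat.clog_le_of_le_pow
    rw [pow_add]
    refine Nat.mul_le_mul (by norm_num) (max_le ?_ ?_)
    · exact (Nat.le_pow_clog one_lt_two y).trans (Nat.pow_le_pow_right two_pos (le_max_left _ _))
    · calc 2 = 2 ^ 1 := rfl
        _ ≤ _ := Nat.pow_le_pow_right two_pos (le_max_right _ _)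
  omega

theorem clog_two_le (n : ℕ) : Nat.clog 2 n ≤ n :=
  Nat.clog_le_of_le_pow Nat.lt_two_pow_self.le

theorem iterate_clog_le (N j : ℕ) : (Nat.clog 2)^[j] N ≤ N := by
  induction j with
  | zero => exact le_rfl
  | succ j ih =>
    rw [Function.iterate_succ_apply']
    exact (clog_two_le _).trans ih

theorem two_le_colorBound (N j : ℕ) : 2 ≤ colorBound N j := by
  unfold colorBound
  omega

end Coloring

/-! ### The iterated logarithm -/

section LogStar

theorem clog_two_lt {n : ℕ} (hn : 2 ≤ n) : Nat.clog 2 n < n := by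
  have h : Nat.clog 2 n ≤ n - 1 := by
    apply Nat.clog_le_of_le_pow
    have := @Nat.lt_two_pow_self (n - 1)
    omega
  omega

theorem exists_iterate_clog_le_one (n : ℕ) : ∃ j, (Nat.clog 2)^[j] n ≤ 1 := by
  induction n using Nat.strong_induction_on with
  | _ n ih =>
    by_cases hn : n ≤ 1
    · exact ⟨0, hn⟩
    · obtain ⟨j, hj⟩ := ih _ (clog_two_lt (not_le.1 hn))
      exact ⟨j + 1, hj⟩

theorem iterate_logStar_le_one (n : ℕ) : (Nat.clog 2)^[logStar n] n ≤ 1 :=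
  Nat.sInf_mem (s := {j | (Nat.clog 2)^[j] n ≤ 1}) (exists_iterate_clog_le_one n)

theorem logStar_le {n j : ℕ} (h : (Nat.clog 2)^[j] n ≤ 1) : logStar n ≤ j := Nat.sInf_le h

theorem logStar_pos {n : ℕ} (hn : 2 ≤ n) : 0 < logStar n := by
  by_contra h
  have := iterate_logStar_le_one n
  rw [Nat.eq_zero_of_not_pos h] at this
  exact absurd (hn.trans this) (by norm_num)

theorem iterate_clog_mono (j : ℕ) : Monotone (Nat.clog 2)^[j] :=
  (Nat.clog_monotone 2).iterate j

/-- As long as the iterates for `n` are positive, those for `n ^ c` exceed them by at most the factor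
`2 ^ c`. -/
theorem logStar_le_add {N n c : ℕ} (hn : 2 ≤ n) (hN : N ≤ n ^ c) :
    logStar N ≤ logStar n + logStar (2 ^ c) := by
  have key : ∀ j, (Nat.clog 2)^[j + 1] N ≤ 2 ^ c * max ((Nat.clog 2)^[j + 1] n) 1 := by
    intro j
    induction j with
    | zero =>
      have h1 : Nat.clog 2 N ≤ Nat.clog 2 n * c := by
        apply Nat.clog_le_of_le_pow
        rw [pow_mul]
        exact hN.trans (Nat.pow_le_pow_left (Nat.le_pow_clog one_lt_two n) c)
      refine h1.trans ?_
      rw [mul_comm]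
      exact Nat.mul_le_mul Nat.lt_two_pow_self.le (le_max_left _ _)
    | succ j ih =>
      rw [Function.iterate_succ_apply', Function.iterate_succ_apply' _ (j + 1) n]
      set y := (Nat.clog 2)^[j + 1] n
      have h1 : Nat.clog 2 ((Nat.clog 2)^[j + 1] N) ≤ c + Nat.clog 2 y := by
        apply Nat.clog_le_of_le_pow
        rw [pow_add]
        refine ih.trans (Nat.mul_le_mul_left _ (max_le (Nat.le_pow_clog one_lt_two y) ?_))
        exact Nat.one_le_two_pow
      have h2 : c + 1 ≤ 2 ^ c := Nat.lt_two_pow_self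
      have h3 : c + Nat.clog 2 y ≤ (c + 1) * max (Nat.clog 2 y) 1 := by
        rw [add_mul, one_mul]
        exact add_le_add (Nat.le_mul_of_pos_right c (by omega)) (le_max_left _ _)
      exact h1.trans (h3.trans (Nat.mul_le_mul_right _ h2))
  obtain ⟨j, hj⟩ : ∃ j, logStar n = j + 1 := Nat.exists_eq_succ_of_ne_zero (logStar_pos hn).ne'
  apply logStar_le
  rw [add_comm, Function.iterate_add_apply]
  refine (iterate_clog_mono _ ?_).trans (iterate_logStar_le_one (2 ^ c))
  have h1 := iterate_logStar_le_one n
  rw [hj] at h1 ⊢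
  refine (key j).trans ?_
  rw [max_eq_right h1, mul_one]

theorem two_pow_clog_le {k : ℕ} (hk : 1 ≤ k) : 2 ^ Nat.clog 2 k ≤ 2 * k := by
  rcases Nat.eq_or_lt_of_le hk with rfl | hk
  · simp
  · have h1 := Nat.pow_pred_clog_lt_self one_lt_two hk
    have hpos : 0 < Nat.clog 2 k := Nat.clog_pos one_lt_two hk
    obtain ⟨m, hm⟩ := Nat.exists_eq_succ_of_ne_zero hpos.ne'
    rw [hm] at h1 ⊢
    rw [Nat.pow_succ]
    simp only [Nat.pred_succ] at h1
    omega

theorem clog_le_logb_add_one {k : ℕ} (hk : 1 ≤ k) :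
    (Nat.clog 2 k : ℝ) ≤ Real.logb 2 k + 1 := by
  have h := Nat.ceil_lt_add_one
    (Real.logb_nonneg one_lt_two (show (1 : ℝ) ≤ (k : ℝ) by exact_mod_cast hk))
  have h2 := Real.natCeil_logb_natCast 2 k
  rw [Nat.cast_ofNat] at h2
  rw [h2] at h
  exact h.le

end LogStar

/-! ### Schedules of synchronous rounds -/

/-- What a vertex does in one round of a fixed schedule, if its memory is of type `X d`, where `d` is
its number of ports. -/
structure Step (X : ℕ → Type) where
  send : ∀ {d : ℕ}, X d → Fin d → Option Message
  recv : ∀ {d : ℕ}, X d → (Fin d → Option Message) → X d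

namespace Network

variable {V : Type*} {X : ℕ → Type}

/-- A global configuration: the memory contents of all vertices. -/
abbrev Config (net : Network V) (X : ℕ → Type) := ∀ v, X (net.deg v)

/-- What `v` receives by ports if the messages `out` are sent. -/
def deliver (net : Network V) (out : ∀ v, Fin (net.deg v) → Option Message) (v : V)
    (i : Fin (net.deg v)) : Option Message :=
  out (net.port v i) ((net.port (net.port v i)).symm ⟨v, (net.port v i).2.symm⟩)

theorem deliver_eq (net : Network V) {out : ∀ v, Fin (net.deg v) → Option Message}
    {G : V → V → Option Message} (h : ∀ u j, out u j = G u (net.port u j)) (v : V)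
    (i : Fin (net.deg v)) : net.deliver out v i = G (net.port v i) v := by
  rw [deliver, h, Equiv.apply_symm_apply]

/-- The configuration after one round. -/
def applyStep (net : Network V) (s : Step X) (σ : net.Config X) : net.Config X :=
  fun v => s.recv (σ v) (net.deliver (fun u => s.send (σ u)) v)

/-- The configuration after the rounds of a schedule. -/
def exec (net : Network V) : List (Step X) → net.Config X → net.Config X
  | [], σ => σ
  | s :: l, σ => exec net l (net.applyStep s σ)

/-- The number of messages sent in one round. -/
def stepCost [Fintype V] (net : Network V) (s : Step X) (σ : net.Config X) : ℕ :=
  ∑ v, ∑ i, if (s.send (σ v) i).isSome then 1 else 0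

/-- The number of messages sent in the rounds of a schedule. -/
def cost [Fintype V] (net : Network V) : List (Step X) → net.Config X → ℕ
  | [], _ => 0
  | s :: l, σ => net.stepCost s σ + cost net l (net.applyStep s σ)

/-- All messages sent in the rounds of a schedule satisfy `good`. -/
def AllMessages (net : Network V) (good : Message → Prop) : List (Step X) → net.Config X → Prop
  | [], _ => True
  | s :: l, σ => (∀ v i m, s.send (σ v) i = some m → good m) ∧
      AllMessages net good l (net.applyStep s σ)

/-- The schedule `l` leads from `σ` to `τ` with at most `M` messages, which all satisfy `good`. -/
structure Runs [Fintype V] (net : Network V) (good : Message → Prop) (l : List (Step X))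
    (σ τ : net.Config X) (M : ℕ) : Prop where
  exec_eq : net.exec l σ = τ
  cost_le : net.cost l σ ≤ M
  allMessages : net.AllMessages good l σ

variable [Fintype V] {net : Network V} {good : Message → Prop} {l l' : List (Step X)}
  {σ τ ρ : net.Config X} {M M' : ℕ}

theorem Runs.nil : net.Runs good [] σ σ 0 := ⟨rfl, le_rfl, trivial⟩

theorem Runs.append (h : net.Runs good l σ τ M) (h' : net.Runs good l' τ ρ M') :
    net.Runs good (l ++ l') σ ρ (M + M') := by
  induction l generalizing σ M with
  | nil =>
    obtain ⟨h1, -, -⟩ := h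
    obtain rfl : σ = τ := h1
    exact ⟨h'.1, h'.2.trans (Nat.le_add_left _ _), h'.3⟩
  | cons s l ih =>
    obtain ⟨h1, h2, h3⟩ := h
    have := ih ⟨h1, le_rfl, h3.2⟩
    refine ⟨this.1, ?_, h3.1, this.3⟩
    have h4 := this.2
    simp only [cost, List.cons_append] at h2 h4 ⊢
    omega

theorem Runs.mono (h : net.Runs good l σ τ M) (hM : M ≤ M') : net.Runs good l σ τ M' :=
  ⟨h.1, h.2.trans hM, h.3⟩

theorem Runs.of_step {s : Step X} (h1 : net.applyStep s σ = τ) (h2 : net.stepCost s σ ≤ M)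
    (h3 : ∀ v i m, s.send (σ v) i = some m → good m) : net.Runs good [s] σ τ M :=
  ⟨h1, h2, h3, trivial⟩

/-- Repeating a block of rounds that maintains an invariant. -/
theorem Runs.repeat {I : ℕ → net.Config X → Prop} {b : ℕ → List (Step X)}
    (h : ∀ j σ, I j σ → ∃ τ, net.Runs good (b j) σ τ M ∧ I (j + 1) τ) (h0 : I 0 σ) (n : ℕ) :
    ∃ τ, net.Runs good ((List.range n).flatMap b) σ τ (n * M) ∧ I n τ := by
  induction n with
  | zero => exact ⟨σ, Runs.nil.mono (Nat.zero_le _), h0⟩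
  | succ n ih =>
    obtain ⟨τ, hτ, hI⟩ := ih
    obtain ⟨ρ, hρ, hI'⟩ := h n τ hI
    refine ⟨ρ, ?_, hI'⟩
    rw [List.range_succ, List.flatMap_append, List.flatMap_singleton, add_mul, one_mul]
    exact hτ.append hρ

/-! ### Counting messages -/

/-- The number of pairs of a vertex `v` and a port with `P` is bounded by injecting them into a finite
set. -/
theorem sum_ports_le_card {A : Type*} (net : Network V) (P : V → V → Prop)
    [∀ v u, Decidable (P v u)] (f : V → V → A) (s : Finset A)
    (hs : ∀ v u, net.graph.Adj v u → P v u → f v u ∈ s)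
    (hf : ∀ v u v' u', net.graph.Adj v u → net.graph.Adj v' u' → P v u → P v' u' →
      f v u = f v' u' → v = v' ∧ u = u') :
    (∑ v, ∑ i : Fin (net.deg v), if P v (net.port v i) then 1 else 0) ≤ s.card := by
  classical
  have h1 : (∑ v, ∑ i : Fin (net.deg v), if P v (net.port v i) then 1 else 0)
      = (Finset.univ.filter fun p : Σ v, Fin (net.deg v) => P p.1 (net.port p.1 p.2)).card := by
    rw [Finset.card_filter, ← Finset.univ_sigma_univ, Finset.sum_sigma]
  rw [h1]
  refine Finset.card_le_card_of_injOn (fun p => f p.1 (net.port p.1 p.2)) ?_ ?_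
  · intro p hp
    exact hs _ _ (net.port p.1 p.2).2 (by simpa using hp)
  · rintro ⟨v, i⟩ hp ⟨v', i'⟩ hp' he
    obtain ⟨h2, h3⟩ := hf _ _ _ _ (net.port v i).2 (net.port v' i').2 (by simpa using hp)
      (by simpa using hp') he
    subst h2
    rw [(net.port v).injective (Subtype.ext h3)]

/-- A round in which every vertex sends through every port. -/
theorem sum_ports_le_edges (net : Network V) (P : V → V → Prop) [∀ v u, Decidable (P v u)] :
    (∑ v, ∑ i : Fin (net.deg v), if P v (net.port v i) then 1 else 0)
      ≤ 2 * net.graph.edgeSet.ncard := by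
  classical
  have h := net.graph.dart_card_eq_twice_card_edges
  rw [Set.ncard_eq_toFinset_card', Set.toFinset_card]
  rw [SimpleGraph.edgeFinset, Set.toFinset_card] at h
  rw [← h]
  calc _ ≤ ∑ v, ∑ i : Fin (net.deg v), 1 := by
        refine Finset.sum_le_sum fun v _ => Finset.sum_le_sum fun i _ => ?_
        split_ifs <;> simp
    _ = Fintype.card net.graph.Dart := by
        rw [net.graph.dart_card_eq_sum_degrees]
        refine Finset.sum_congr rfl fun v _ => ?_
        rw [Finset.sum_const, Finset.card_univ, Fintype.card_congr (net.port v),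
          smul_eq_mul, mul_one, SimpleGraph.card_neighborSet_eq_degree]

/-- Messages along at most one outgoing edge of every vertex. -/
theorem sum_ports_le_card_of_right_unique (net : Network V) (P : V → V → Prop)
    [∀ v u, Decidable (P v u)] (h : ∀ v u u', P v u → P v u' → u = u') :
    (∑ v, ∑ i : Fin (net.deg v), if P v (net.port v i) then 1 else 0) ≤ Fintype.card V :=
  net.sum_ports_le_card P (fun v _ => v) Finset.univ (fun _ _ _ _ => Finset.mem_univ _)
    (by rintro v u v' u' - - h1 h2 rfl; exact ⟨rfl, h _ _ _ h1 h2⟩)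

/-- Messages along at most one incoming edge of every vertex. -/
theorem sum_ports_le_card_of_left_unique (net : Network V) (P : V → V → Prop)
    [∀ v u, Decidable (P v u)] (h : ∀ v v' u, P v u → P v' u → v = v') :
    (∑ v, ∑ i : Fin (net.deg v), if P v (net.port v i) then 1 else 0) ≤ Fintype.card V :=
  net.sum_ports_le_card P (fun _ u => u) Finset.univ (fun _ _ _ _ => Finset.mem_univ _)
    (by rintro v u v' u' - - h1 h2 rfl; exact ⟨h _ _ _ h1 h2, rfl⟩)

/-- Messages along the edges of a subgraph of a tree. -/
theorem sum_ports_le_of_le_tree (net : Network V) {T : SimpleGraph V} (hT : T.IsTree)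
    (P : V → V → Prop) [∀ v u, Decidable (P v u)] (h : ∀ v u, P v u → T.Adj v u) :
    (∑ v, ∑ i : Fin (net.deg v), if P v (net.port v i) then 1 else 0)
      ≤ 2 * Fintype.card V := by
  classical
  have h1 := net.sum_ports_le_card P (fun v u => (v, u))
    (Finset.univ.filter fun p : V × V => T.Adj p.1 p.2)
    (fun v u _ hp => by simpa using h v u hp)
    (by rintro v u v' u' - - - - h2; exact Prod.mk.inj h2)
  refine h1.trans ?_
  have h2 := hT.card_edgeFinset
  have h3 := T.dart_card_eq_twice_card_edges
  have h4 : (Finset.univ.filter fun p : V × V => T.Adj p.1 p.2).card ≤ Fintype.card T.Dart := by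
    rw [← Finset.card_univ]
    have : (Finset.univ.filter fun p : V × V => T.Adj p.1 p.2)
        ⊆ Finset.univ.image (fun d : T.Dart => d.toProd) := by
      intro p hp
      exact Finset.mem_image.2 ⟨⟨p, by simpa using hp⟩, Finset.mem_univ _, rfl⟩
    exact (Finset.card_le_card this).trans Finset.card_image_le
  omega

end Network

/-! ### The protocol of a schedule -/

/-- The protocol in which the vertices follow the schedule `prog N k`, which depends on common
knowledge only, and halt at its end. The state consists of the remaining rounds and the memory. -/
def scheduledProtocol {X : ℕ → Type} (prog : ℕ → ℕ → List (Step X))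
    (init : ∀ {d : ℕ}, ℕ → (Fin d → ℝ) → X d) (out : ∀ {d : ℕ}, X d → LocalResult d) :
    Protocol where
  State d := List (Step X) × X d
  init N k ident w := (prog N k, init ident w)
  send s i := match s.1 with
    | [] => none
    | a :: _ => a.send s.2 i
  receive s m := match s.1 with
    | [] => s
    | a :: l => (l, a.recv s.2 m)
  result s := match s.1 with
    | [] => some (out s.2)
    | _ :: _ => none

section ScheduledProtocol

variable {X : ℕ → Type} {prog : ℕ → ℕ → List (Step X)}
  {init : ∀ {d : ℕ}, ℕ → (Fin d → ℝ) → X d} {out : ∀ {d : ℕ}, X d → LocalResult d}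
  {V : Type*} {net : Network V} {N k : ℕ}

theorem run_succ_of_cons {r : ℕ} {s : Step X} {l : List (Step X)} {σ : net.Config X}
    (h : (scheduledProtocol prog init out).run net N k r = fun v => (s :: l, σ v)) :
    (scheduledProtocol prog init out).run net N k (r + 1)
      = fun v => (l, net.applyStep s σ v) := by
  funext v
  rw [Protocol.run, h]
  rfl

theorem run_add_of_nil {r : ℕ} {σ : net.Config X}
    (h : (scheduledProtocol prog init out).run net N k r = fun v => ([], σ v)) (j : ℕ) :
    (scheduledProtocol prog init out).run net N k (r + j) = fun v => ([], σ v) := by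
  induction j with
  | zero => exact h
  | succ j ih =>
    funext v
    rw [← Nat.add_assoc, Protocol.run, ih]
    rfl

/-- At the end of the schedule all vertices have halted with the final memory contents. -/
theorem run_add_length (l : List (Step X)) {r : ℕ} {σ : net.Config X}
    (h : (scheduledProtocol prog init out).run net N k r = fun v => (l, σ v)) :
    (scheduledProtocol prog init out).run net N k (r + l.length)
      = fun v => ([], net.exec l σ v) := by
  induction l generalizing r σ with
  | nil => exact h
  | cons s l ih =>
    have := ih (run_succ_of_cons h)
    rw [List.length_cons, Nat.add_comm l.length, ← Nat.add_assoc]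
    exact this

theorem messageCount_add_length [Fintype V] (l : List (Step X)) {r : ℕ} {σ : net.Config X}
    (h : (scheduledProtocol prog init out).run net N k r = fun v => (l, σ v)) :
    (∑ j ∈ Finset.range l.length, ∑ v, ∑ i,
      if ((scheduledProtocol prog init out).sent net N k (r + j) v i).isSome then 1 else 0)
      = net.cost l σ := by
  induction l generalizing r σ with
  | nil => rfl
  | cons s l ih =>
    rw [List.length_cons, Finset.sum_range_succ', Network.cost, add_comm,
      ← ih (run_succ_of_cons h)]
    congr 1
    · rw [Network.stepCost]
      refine Finset.sum_congr rfl fun v _ => Finset.sum_congr rfl fun i _ => ?_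
      rw [Nat.add_zero, Protocol.sent, h]
      rfl
    · refine Finset.sum_congr rfl fun j _ => ?_
      rw [Nat.add_assoc, Nat.add_comm 1 j]

theorem good_of_sent {good : Message → Prop} (l : List (Step X)) {r : ℕ} {σ : net.Config X}
    (h : (scheduledProtocol prog init out).run net N k r = fun v => (l, σ v))
    (hl : net.AllMessages good l σ) (j : ℕ) (v : V) (i : Fin (net.deg v)) (m : Message)
    (hm : (scheduledProtocol prog init out).sent net N k (r + j) v i = some m) : good m := by
  induction l generalizing r σ j with
  | nil =>
    rw [Protocol.sent, run_add_of_nil h j] at hm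
    exact absurd hm (by simp [Protocol.outbox, scheduledProtocol])
  | cons s l ih =>
    cases j with
    | zero =>
      rw [Protocol.sent, Nat.add_zero, h] at hm
      exact hl.1 v i m hm
    | succ j =>
      refine ih (run_succ_of_cons h) hl.2 j ?_
      rw [Nat.add_assoc, Nat.add_comm 1 j]
      exact hm

end ScheduledProtocol

/-! ### Aggregation in the fragments -/

/-- A type of values that fit into a message. -/
class MessageCode (A : Type) where
  enc : A → Message
  dec : Message → A
  dec_enc : ∀ a, dec (enc a) = a

/-- Information on the tree edges at a vertex that is gathered during an aggregation: by ports, the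
messages received so far, and whether the message of the vertex itself has been sent. -/
@[ext]
structure Buffer (d : ℕ) where
  got : Fin d → Option Message
  done : Fin d → Bool

/-- The buffer at the beginning of an aggregation. -/
def Buffer.empty {d : ℕ} : Buffer d := ⟨fun _ => none, fun _ => false⟩

/-- The parameters of an aggregation, in which every vertex learns the least of the values `val` in
its fragment, where `tree` marks the ports of the fragment. -/
structure Aggregation (S : ℕ → Type) (A : Type) where
  tree : ∀ {d : ℕ}, S d → Fin d → Bool
  val : ∀ {d : ℕ}, S d → A

namespace Aggregation

variable {S : ℕ → Type} {A : Type} [LinearOrder A] [OrderTop A] [MessageCode A]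
  (a : Aggregation S A)

/-- The message of a vertex for port `i` can be sent when all other neighbours in the fragment have
reported. -/
def ready {d : ℕ} (x : S d) (b : Buffer d) (i : Fin d) : Prop :=
  a.tree x i = true ∧ b.done i = false ∧ ∀ j, j ≠ i → a.tree x j = true → (b.got j).isSome

/-- The value received through port `j`. -/
def heard {d : ℕ} (b : Buffer d) (j : Fin d) : A := (b.got j).elim ⊤ MessageCode.dec

open Classical in
/-- The least value on the own side of port `i`, if all other neighbours have reported. -/
noncomputable def partialValue {d : ℕ} (x : S d) (b : Buffer d) (i : Fin d) : A :=
  a.val x ⊓ (Finset.univ.filter fun j => j ≠ i ∧ a.tree x j = true).inf (heard b)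

open Classical in
/-- A round of the aggregation. -/
noncomputable def step : Step (fun d => S d × Buffer d) where
  send s i := if a.ready s.1 s.2 i then some (MessageCode.enc (a.partialValue s.1 s.2 i)) else none
  recv s m := (s.1, ⟨fun i => if (m i).isSome then m i else s.2.got i,
    fun i => decide (s.2.done i = true ∨ a.ready s.1 s.2 i)⟩)

open Classical in
/-- The result of the aggregation at a vertex; `none` if a neighbour has not reported in time. -/
noncomputable def outcome {d : ℕ} (x : S d) (b : Buffer d) : Option A :=
  if ∀ j, a.tree x j = true → (b.got j).isSome then
    some (a.val x ⊓ (Finset.univ.filter fun j => a.tree x j = true).inf (heard b))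
  else none

/-- A round without messages, in which every vertex stores the result of the aggregation. -/
noncomputable def finish (store : ∀ {d : ℕ}, S d → Option A → S d) :
    Step (fun d => S d × Buffer d) where
  send _ _ := none
  recv s _ := (store s.1 (a.outcome s.1 s.2), Buffer.empty)

/-- An aggregation of `r` rounds. -/
noncomputable def steps (r : ℕ) (store : ∀ {d : ℕ}, S d → Option A → S d) :
    List (Step (fun d => S d × Buffer d)) :=
  List.replicate r a.step ++ [a.finish store]

end Aggregation

section

variable {V : Type*} {S : ℕ → Type}

/-- The configuration with the given memory contents and empty buffers. -/
def withBuffer {net : Network V} (σ : net.Config S) : net.Config (fun d => S d × Buffer d) :=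
  fun v => (σ v, Buffer.empty)

end

namespace Aggregation

section

variable {V : Type*} {H : SimpleGraph V}

/-- The message from `v` to its neighbour `u` has been sent after `r` rounds: the branch of `v` has
height less than `r`. -/
def Reported (H : SimpleGraph V) (r : ℕ) (v u : V) : Prop :=
  H.Adj v u ∧ ∀ x ∈ branch H v u, H.dist v x < r

theorem Reported.mono {r r' : ℕ} {v u : V} (h : Reported H r v u) (hr : r ≤ r') :
    Reported H r' v u := ⟨h.1, fun x hx => (h.2 x hx).trans_le hr⟩

theorem not_reported_zero {v u : V} : ¬ Reported H 0 v u := fun h =>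
  absurd (h.2 v (self_mem_branch h.1.symm)) (Nat.not_lt_zero _)

/-- The recursion by which reports spread: `v` reports one round after its other neighbours. -/
theorem reported_succ (hH : H.IsAcyclic) {r : ℕ} {v u : V} :
    Reported H (r + 1) v u ↔ H.Adj v u ∧ ∀ w, H.Adj v w → w ≠ u → Reported H r w v := by
  constructor
  · rintro ⟨hvu, h⟩
    refine ⟨hvu, fun w hw hne => ⟨hw.symm, fun x hx => ?_⟩⟩
    have h1 := h x ((mem_branch_iff hH hvu).2 (Or.inr ⟨w, hw, hne, hx⟩))
    have h2 := hx.2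
    omega
  · rintro ⟨hvu, h⟩
    refine ⟨hvu, fun x hx => ?_⟩
    rcases (mem_branch_iff hH hvu).1 hx with rfl | ⟨w, hw, hne, hxw⟩
    · rw [SimpleGraph.dist_self]
      exact Nat.succ_pos r
    · have h1 := (h w hw hne).2 x hxw
      have h2 := hxw.2
      omega

end

section

variable {S : ℕ → Type} {A : Type} {a : Aggregation S A} {V : Type*} {net : Network V}
  {H : SimpleGraph V} {σ : net.Config S}

theorem exists_port (hHG : H ≤ net.graph) {v u : V} (h : H.Adj v u) :
    ∃ i, (net.port v i : V) = u :=
  ⟨(net.port v).symm ⟨u, hHG h⟩, by rw [Equiv.apply_symm_apply]⟩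

theorem forall_port_iff (hHG : H ≤ net.graph)
    (htree : ∀ v i, a.tree (σ v) i = true ↔ H.Adj v (net.port v i)) {v : V} {P : V → Prop} :
    (∀ j, a.tree (σ v) j = true → P (net.port v j)) ↔ ∀ w, H.Adj v w → P w := by
  constructor
  · intro h w hw
    have hj : ((net.port v ((net.port v).symm ⟨w, hHG hw⟩) : _) : V) = w := by
      rw [Equiv.apply_symm_apply]
    have := h ((net.port v).symm ⟨w, hHG hw⟩)
    rw [htree, hj] at this
    exact this hw
  · exact fun h j hj => h _ ((htree v j).1 hj)

end

section

variable {A : Type} [LinearOrder A] [OrderTop A] {V : Type*} [Fintype V] {H : SimpleGraph V}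

open Classical in
/-- The least value in the branch of `v`. -/
noncomputable def branchInf (H : SimpleGraph V) (f : V → A) (v u : V) : A :=
  (Finset.univ.filter (· ∈ branch H v u)).inf f

open Classical in
/-- The least value in the fragment of `v`. -/
noncomputable def fragmentInf (H : SimpleGraph V) (f : V → A) (v : V) : A :=
  (Finset.univ.filter (H.Reachable v)).inf f

open Classical in
/-- The result of the aggregation after `r` rounds at `v`. It reveals whether all vertices of the
fragment are within distance `r` of `v`. -/
noncomputable def outcomeAfter (H : SimpleGraph V) (f : V → A) (r : ℕ) (v : V) : Option A :=
  if ∀ x, H.Reachable v x → H.dist v x ≤ r then some (fragmentInf H f v) else none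

theorem exists_branchInf_eq {f : V → A} {v u : V} (h : H.Adj v u) :
    ∃ x, branchInf H f v u = f x := by
  classical
  obtain ⟨x, -, hx⟩ := Finset.exists_mem_eq_inf _
    ⟨v, Finset.mem_filter.2 ⟨Finset.mem_univ v, self_mem_branch h.symm⟩⟩ f
  exact ⟨x, hx⟩

theorem fragmentInf_le {f : V → A} {v x : V} (h : H.Reachable v x) : fragmentInf H f v ≤ f x := by
  classical
  exact Finset.inf_le (Finset.mem_filter.2 ⟨Finset.mem_univ x, h⟩)

theorem exists_fragmentInf_eq (H : SimpleGraph V) (f : V → A) (v : V) :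
    ∃ x, H.Reachable v x ∧ fragmentInf H f v = f x := by
  classical
  obtain ⟨x, hx, he⟩ := Finset.exists_mem_eq_inf _
    ⟨v, Finset.mem_filter.2 ⟨Finset.mem_univ v, SimpleGraph.Reachable.refl (G := H) v⟩⟩ f
  exact ⟨x, (Finset.mem_filter.1 hx).2, he⟩

theorem fragmentInf_congr {f : V → A} {v w : V} (h : H.Reachable v w) :
    fragmentInf H f v = fragmentInf H f w := by
  classical
  unfold fragmentInf
  congr 1
  ext x
  simp only [Finset.mem_filter, Finset.mem_univ, true_and]
  exact ⟨h.symm.trans, h.trans⟩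

theorem outcomeAfter_of_diam {f : V → A} {r : ℕ} (h : ∀ F : H.ConnectedComponent,
    FragmentDiamLE H F r) (v : V) : outcomeAfter H f r v = some (fragmentInf H f v) := by
  unfold outcomeAfter
  exact if_pos fun x hx => h (H.connectedComponentMk v) v rfl x
    (SimpleGraph.ConnectedComponent.sound hx.symm)

end

variable {S : ℕ → Type} {A : Type} [LinearOrder A] [OrderTop A] [MessageCode A]
  {a : Aggregation S A}
variable {V : Type*} [Fintype V] {net : Network V} {H : SimpleGraph V}

open Classical in
/-- The buffers after `r` rounds. -/
noncomputable def bufferAfter (net : Network V) (H : SimpleGraph V) (f : V → A) (r : ℕ) (v : V) :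
    Buffer (net.deg v) where
  got i := if Reported H r (net.port v i) v then
    some (MessageCode.enc (branchInf H f (net.port v i) v)) else none
  done i := decide (Reported H r v (net.port v i))

variable {σ : net.Config S}

open Classical in
theorem bufferAfter_got (f : V → A) (r : ℕ) (v : V) (i : Fin (net.deg v)) :
    (bufferAfter net H f r v).got i = if Reported H r (net.port v i) v then
      some (MessageCode.enc (branchInf H f (net.port v i) v)) else none := rfl

open Classical in
theorem bufferAfter_done (f : V → A) (r : ℕ) (v : V) (i : Fin (net.deg v)) :
    (bufferAfter net H f r v).done i = decide (Reported H r v (net.port v i)) := rfl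

theorem isSome_got {f : V → A} {r : ℕ} {v : V} {j : Fin (net.deg v)} :
    (((bufferAfter net H f r v).got j).isSome = true) ↔ Reported H r (net.port v j) v := by
  unfold bufferAfter
  dsimp only
  split_ifs with h <;> simp [h]

theorem heard_bufferAfter {f : V → A} {r : ℕ} {v : V} {j : Fin (net.deg v)}
    (h : Reported H r (net.port v j) v) :
    heard (bufferAfter net H f r v) j = branchInf H f (net.port v j) v := by
  unfold bufferAfter heard
  dsimp only
  rw [if_pos h]
  exact MessageCode.dec_enc _

theorem ready_iff (hH : H.IsAcyclic) (hHG : H ≤ net.graph)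
    (htree : ∀ v i, a.tree (σ v) i = true ↔ H.Adj v (net.port v i)) {f : V → A} {r : ℕ} {v : V}
    {i : Fin (net.deg v)} :
    a.ready (σ v) (bufferAfter net H f r v) i ↔
      Reported H (r + 1) v (net.port v i) ∧ ¬ Reported H r v (net.port v i) := by
  classical
  have h := forall_port_iff hHG htree (v := v)
    (P := fun w => w ≠ net.port v i → Reported H r w v)
  have hinj : ∀ j, j ≠ i ↔ (net.port v j : V) ≠ net.port v i := fun j =>
    not_congr ⟨fun h => by rw [h], fun h => (net.port v).injective (Subtype.ext h)⟩
  simp only [ready, isSome_got, reported_succ hH, ← h, ← hinj, htree]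
  have hd : (bufferAfter net H f r v).done i = false ↔ ¬ Reported H r v (net.port v i) := by
    simp [bufferAfter]
  rw [hd]
  constructor
  · rintro ⟨h1, h2, h3⟩
    exact ⟨⟨h1, fun j h4 h5 => h3 j h5 h4⟩, h2⟩
  · rintro ⟨⟨h1, h3⟩, h2⟩
    exact ⟨h1, h2, fun j h4 h5 => h3 j h5 h4⟩

theorem partialValue_eq (hH : H.IsAcyclic) (hHG : H ≤ net.graph)
    (htree : ∀ v i, a.tree (σ v) i = true ↔ H.Adj v (net.port v i)) {f : V → A}
    (hf : ∀ v, a.val (σ v) = f v) {r : ℕ} {v : V} {i : Fin (net.deg v)}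
    (h : Reported H (r + 1) v (net.port v i)) :
    a.partialValue (σ v) (bufferAfter net H f r v) i = branchInf H f v (net.port v i) := by
  classical
  have hrep := (reported_succ hH).1 h
  have hj : ∀ j, j ≠ i → a.tree (σ v) j = true →
      heard (bufferAfter net H f r v) j = branchInf H f (net.port v j) v := by
    intro j hj ht
    exact heard_bufferAfter (hrep.2 _ ((htree v j).1 ht) fun he =>
      hj ((net.port v).injective (Subtype.ext he)))
  unfold partialValue
  apply le_antisymm
  · refine Finset.le_inf fun x hx => ?_
    rcases (mem_branch_iff hH h.1).1 (Finset.mem_filter.1 hx).2 with rfl | ⟨w, hw, hne, hxw⟩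
    · rw [hf]
      exact inf_le_left
    · obtain ⟨j, rfl⟩ := exists_port hHG hw
      have hji : j ≠ i := fun he => hne (by rw [he])
      have ht := (htree v j).2 hw
      refine inf_le_right.trans ((Finset.inf_le
        (Finset.mem_filter.2 ⟨Finset.mem_univ j, hji, ht⟩)).trans ?_)
      rw [hj j hji ht]
      exact Finset.inf_le (Finset.mem_filter.2 ⟨Finset.mem_univ x, hxw⟩)
  · refine le_inf ?_ (Finset.le_inf fun j hjm => ?_)
    · rw [hf]
      exact Finset.inf_le (Finset.mem_filter.2 ⟨Finset.mem_univ v, self_mem_branch h.1.symm⟩)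
    · obtain ⟨-, hji, ht⟩ := Finset.mem_filter.1 hjm
      rw [hj j hji ht]
      refine Finset.le_inf fun x hx => Finset.inf_le (Finset.mem_filter.2 ⟨Finset.mem_univ x, ?_⟩)
      exact (mem_branch_iff hH h.1).2 (Or.inr ⟨_, (htree v j).1 ht,
        fun he => hji ((net.port v).injective (Subtype.ext he)), (Finset.mem_filter.1 hx).2⟩)

theorem outcome_eq (hHG : H ≤ net.graph)
    (htree : ∀ v i, a.tree (σ v) i = true ↔ H.Adj v (net.port v i)) {f : V → A}
    (hf : ∀ v, a.val (σ v) = f v) (r : ℕ) (v : V) :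
    a.outcome (σ v) (bufferAfter net H f r v) = outcomeAfter H f r v := by
  classical
  have hcond : (∀ j, a.tree (σ v) j = true → ((bufferAfter net H f r v).got j).isSome = true) ↔
      ∀ x, H.Reachable v x → H.dist v x ≤ r := by
    simp only [isSome_got]
    rw [forall_port_iff hHG htree (P := fun w => Reported H r w v)]
    constructor
    · intro h x hx
      rcases reachable_iff_branch.1 hx with rfl | ⟨w, hw, hxw⟩
      · rw [SimpleGraph.dist_self]
        exact Nat.zero_le r
      · have h1 := (h w hw).2 x hxw
        have h2 := hxw.2
        omega
    · intro h w hw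
      refine ⟨hw.symm, fun x hx => ?_⟩
      have h1 := h x (hw.reachable.trans hx.1)
      have h2 := hx.2
      omega
  unfold outcome outcomeAfter
  by_cases h : ∀ x, H.Reachable v x → H.dist v x ≤ r
  · rw [if_pos (hcond.2 h), if_pos h]
    congr 1
    have hj : ∀ j, a.tree (σ v) j = true →
        heard (bufferAfter net H f r v) j = branchInf H f (net.port v j) v := fun j ht =>
      heard_bufferAfter (isSome_got.1 (hcond.2 h j ht))
    apply le_antisymm
    · refine Finset.le_inf fun x hx => ?_
      rcases reachable_iff_branch.1 (Finset.mem_filter.1 hx).2 with rfl | ⟨w, hw, hxw⟩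
      · rw [hf]
        exact inf_le_left
      · obtain ⟨j, rfl⟩ := exists_port hHG hw
        have ht := (htree v j).2 hw
        refine inf_le_right.trans ((Finset.inf_le
          (Finset.mem_filter.2 ⟨Finset.mem_univ j, ht⟩)).trans ?_)
        rw [hj j ht]
        exact Finset.inf_le (Finset.mem_filter.2 ⟨Finset.mem_univ x, hxw⟩)
    · refine le_inf ?_ (Finset.le_inf fun j hjm => ?_)
      · rw [hf]
        exact Finset.inf_le (Finset.mem_filter.2
          ⟨Finset.mem_univ v, SimpleGraph.Reachable.refl v⟩)
      · obtain ⟨-, ht⟩ := Finset.mem_filter.1 hjm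
        rw [hj j ht]
        refine Finset.le_inf fun x hx =>
          Finset.inf_le (Finset.mem_filter.2 ⟨Finset.mem_univ x, ?_⟩)
        exact reachable_iff_branch.2 (Or.inr ⟨_, (htree v j).1 ht, (Finset.mem_filter.1 hx).2⟩)
  · rw [if_neg (fun h' => h (hcond.1 h')), if_neg h]

open Classical in
/-- The message from `v` to a neighbour in the fragment is sent in the round whose number is the
height of the branch of `v`, so that every tree edge carries one message in each direction. -/
theorem runs_replicate {good : Message → Prop} (hH : H.IsAcyclic) (hHG : H ≤ net.graph)
    (htree : ∀ v i, a.tree (σ v) i = true ↔ H.Adj v (net.port v i)) {f : V → A}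
    (hf : ∀ v, a.val (σ v) = f v) (hgood : ∀ v, good (MessageCode.enc (f v))) (r : ℕ) :
    net.Runs good (List.replicate r a.step) (withBuffer σ)
      (fun v => (σ v, bufferAfter net H f r v))
      (∑ v, ∑ i : Fin (net.deg v), if Reported H r v (net.port v i) then 1 else 0) := by
  classical
  induction r with
  | zero =>
    refine ⟨?_, Nat.zero_le _, trivial⟩
    funext v
    simp [Network.exec, withBuffer, bufferAfter, Buffer.empty, not_reported_zero]
  | succ r ih =>
    rw [List.replicate_succ']
    have hsend : ∀ u j, a.step.send (σ u, bufferAfter net H f r u) j =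
        (fun v w => if Reported H (r + 1) v w ∧ ¬ Reported H r v w then
          some (MessageCode.enc (branchInf H f v w)) else none) u (net.port u j) := by
      intro u j
      simp only [step, ready_iff hH hHG htree]
      by_cases h : Reported H (r + 1) u (net.port u j) ∧ ¬ Reported H r u (net.port u j)
      · rw [if_pos h, if_pos h, partialValue_eq hH hHG htree hf h.1]
      · rw [if_neg h, if_neg h]
    have hstep : net.Runs good [a.step] (fun v => (σ v, bufferAfter net H f r v))
        (fun v => (σ v, bufferAfter net H f (r + 1) v))
        (∑ v, ∑ i : Fin (net.deg v), if Reported H (r + 1) v (net.port v i) ∧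
          ¬ Reported H r v (net.port v i) then 1 else 0) := by
      refine Network.Runs.of_step ?_ (le_of_eq ?_) ?_
      · funext v
        unfold Network.applyStep
        have hdel := net.deliver_eq (out := fun u j => a.step.send (σ u, bufferAfter net H f r u) j)
          (G := fun v w => if Reported H (r + 1) v w ∧ ¬ Reported H r v w then
            some (MessageCode.enc (branchInf H f v w)) else none) hsend v
        simp only [step] at hdel ⊢
        refine Prod.ext rfl (Buffer.ext (funext fun i => ?_) (funext fun i => ?_))
        · dsimp only
          rw [hdel, bufferAfter_got, bufferAfter_got]
          by_cases h1 : Reported H r (net.port v i) v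
          · rw [if_pos h1, if_pos (h1.mono (Nat.le_succ r)), if_neg]
            rw [if_neg (fun h => h.2 h1)]
            simp
          · by_cases h2 : Reported H (r + 1) (net.port v i) v
            · simp [h1, h2]
            · simp [h1, h2]
        · dsimp only
          rw [bufferAfter_done, bufferAfter_done, decide_eq_decide,
            ready_iff (f := f) (r := r) hH hHG htree, decide_eq_true_iff]
          constructor
          · rintro (h | h)
            · exact h.mono (Nat.le_succ r)
            · exact h.1
          · intro h
            by_cases h1 : Reported H r v (net.port v i)
            · exact Or.inl h1
            · exact Or.inr ⟨h, h1⟩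
      · unfold Network.stepCost
        refine Finset.sum_congr rfl fun v _ => Finset.sum_congr rfl fun i _ => ?_
        rw [hsend]
        dsimp only
        split_ifs <;> simp_all
      · intro v i m hm
        rw [hsend] at hm
        dsimp only at hm
        split_ifs at hm with h
        obtain ⟨x, hx⟩ := exists_branchInf_eq (f := f) h.1.1
        rw [← Option.some.inj hm, hx]
        exact hgood x
    refine (ih.append hstep).mono (le_of_eq ?_)
    rw [← Finset.sum_add_distrib]
    refine Finset.sum_congr rfl fun v _ => ?_
    rw [← Finset.sum_add_distrib]
    refine Finset.sum_congr rfl fun i _ => ?_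
    have hm : Reported H r v (net.port v i) → Reported H (r + 1) v (net.port v i) :=
      fun h => h.mono (Nat.le_succ r)
    by_cases h1 : Reported H r v (net.port v i)
    · simp [h1, hm h1]
    · simp [h1]

/-- The effect of an aggregation of `r` rounds. -/
theorem runs_steps {good : Message → Prop} {T : SimpleGraph V} (hT : T.IsTree) (hHT : H ≤ T)
    (hHG : H ≤ net.graph)
    (htree : ∀ v i, a.tree (σ v) i = true ↔ H.Adj v (net.port v i)) (f : V → A)
    (hf : ∀ v, a.val (σ v) = f v) (hgood : ∀ v, good (MessageCode.enc (f v))) (r : ℕ)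
    (store : ∀ {d : ℕ}, S d → Option A → S d) :
    net.Runs good (a.steps r store) (withBuffer σ)
      (withBuffer fun v => store (σ v) (outcomeAfter H f r v)) (2 * Fintype.card V) := by
  classical
  refine ((runs_replicate (hT.isAcyclic.anti hHT) hHG htree hf hgood r).append
    (Network.Runs.of_step (M := 0) ?_ ?_ ?_)).mono
    (net.sum_ports_le_of_le_tree hT (Reported H r) fun v u h => hHT h.1)
  · funext v
    simp only [Network.applyStep, finish, withBuffer, outcome_eq hHG htree hf r v]
  · simp [Network.stepCost, finish]
  · intro v i m hm
    simp [finish] at hm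

theorem length_steps (r : ℕ) (store : ∀ {d : ℕ}, S d → Option A → S d) :
    (a.steps r store).length = r + 1 := by
  simp [steps]

end Aggregation

/-- A round of messages to neighbours. -/
def exchange {S : ℕ → Type} (send : ∀ {d : ℕ}, S d → Fin d → Option Message)
    (recv : ∀ {d : ℕ}, S d → (Fin d → Option Message) → S d) :
    Step (fun d => S d × Buffer d) where
  send s := send s.1
  recv s m := (recv s.1 m, s.2)

/-- The effect of a round in which the message from a vertex to a neighbour is given by `G`. -/
theorem runs_exchange {V : Type*} [Fintype V] {net : Network V} {S : ℕ → Type}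
    {send : ∀ {d : ℕ}, S d → Fin d → Option Message}
    {recv : ∀ {d : ℕ}, S d → (Fin d → Option Message) → S d} {good : Message → Prop}
    {σ : net.Config S} (G : V → V → Option Message) {M : ℕ}
    (hG : ∀ v i, send (σ v) i = G v (net.port v i))
    (hM : (∑ v, ∑ i : Fin (net.deg v), if (G v (net.port v i)).isSome then 1 else 0) ≤ M)
    (hgood : ∀ v u m, G v u = some m → good m) :
    net.Runs good [exchange send recv] (withBuffer σ)
      (withBuffer fun v => recv (σ v) fun i => G (net.port v i) v) M := by
  refine Network.Runs.of_step ?_ ?_ ?_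
  · funext v
    have hdel := funext (net.deliver_eq (out := fun u => send (σ u)) hG v)
    simp only [Network.applyStep, exchange, withBuffer, hdel]
  · refine le_trans (le_of_eq ?_) hM
    unfold Network.stepCost
    refine Finset.sum_congr rfl fun v _ => Finset.sum_congr rfl fun i _ => ?_
    simp only [exchange, withBuffer, hG]
  · intro v i m hm
    exact hgood v (net.port v i) m (by rw [← hG]; exact hm)

/-- A number is sent as it is, and `⊤` as a message without contents. -/
instance : MessageCode (WithTop ℕ) where
  enc a := ⟨a.recTopCoe [] fun n => [n], []⟩
  dec m := match m.nums with
    | [] => ⊤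
    | n :: _ => n
  dec_enc a := by cases a <;> rfl

/-- `⊤` is sent as a message without contents, so that only weights of edges occur in messages. -/
noncomputable instance : MessageCode (WithTop (ℝ ×ₗ ℕ)) where
  enc a := a.recTopCoe ⟨[], []⟩ fun p => ⟨[(ofLex p).2], [(ofLex p).1]⟩
  dec m := match m.nums, m.weights with
    | n :: _, x :: _ => (toLex (x, n) : ℝ ×ₗ ℕ)
    | _, _ => ⊤
  dec_enc a := by cases a <;> rfl

/-! ### The schedule of a phase -/

/-- The memory of a vertex with `d` ports. -/
structure Memory (d : ℕ) where
  /-- the own identity number -/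
  ident : ℕ
  /-- the weights of the incident edges -/
  weight : Fin d → ℝ
  /-- the incident edges that belong to the forest -/
  tree : Fin d → Bool
  /-- the least identity number in the fragment -/
  fid : ℕ
  /-- the values `fid` of the neighbours -/
  nfid : Fin d → ℕ
  /-- all vertices of the fragment are close -/
  small : Bool
  /-- the fragment is active -/
  active : Bool
  /-- the port of the chosen edge of the fragment, at its inner end -/
  out : Fin d → Bool
  /-- the ports of the chosen edges of other fragments that end here -/
  inn : Fin d → Bool
  /-- the colour of the fragment -/
  color : ℕ
  /-- the fragment is inactive or matched -/
  matched : Bool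
  /-- the fragment is matched with the fragment to which its chosen edge leads -/
  accepted : Bool
  /-- the contribution to the next aggregation -/
  report : WithTop ℕ
  /-- the ports through which other fragments have proposed to be matched -/
  proposed : Fin d → Bool
  /-- the port of the proposal that has been accepted -/
  accepting : Fin d → Bool

/-- A message that consists of a number. -/
def numMessage (n : ℕ) : Message := ⟨[n], []⟩

/-- A message without contents. -/
def token : Message := ⟨[], []⟩

/-- `i` is the first port with the property `P`. -/
def FirstPort {d : ℕ} (P : Fin d → Prop) (i : Fin d) : Prop :=
  P i ∧ ∀ j < i, ¬ P j

theorem FirstPort.unique {d : ℕ} {P : Fin d → Prop} {i j : Fin d} (hi : FirstPort P i)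
    (hj : FirstPort P j) : i = j := by
  rcases lt_trichotomy i j with h | h | h
  · exact absurd hi.1 (hj.2 i h)
  · exact h
  · exact absurd hj.1 (hi.2 j h)

theorem exists_firstPort {d : ℕ} {P : Fin d → Prop} (h : ∃ i, P i) : ∃ i, FirstPort P i := by
  obtain ⟨i, hi⟩ := h
  obtain ⟨j, hj, hmin⟩ := (Set.toFinite {i | P i}).exists_minimal ⟨i, hi⟩
  exact ⟨j, hj, fun l hl hP => absurd (hmin hP hl.le) (not_le.2 hl)⟩

namespace Schedule

/-- The aggregation of the least of the numbers `val` in a fragment. -/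
def minimum (val : ∀ {d : ℕ}, Memory d → WithTop ℕ) : Aggregation Memory (WithTop ℕ) where
  tree x := x.tree
  val := val

/-- The least weight of an edge to another fragment, with the own identity number, which breaks ties
between the vertices of a fragment. -/
noncomputable def bestEdge {d : ℕ} (x : Memory d) : WithTop (ℝ ×ₗ ℕ) :=
  (Finset.univ.filter fun i => x.nfid i ≠ x.fid).inf
    fun i => ((toLex (x.weight i, x.ident) : ℝ ×ₗ ℕ) : WithTop (ℝ ×ₗ ℕ))

/-- A round of the algorithm. -/
abbrev Round := Step (fun d => Memory d × Buffer d)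

/-- The vertices of every fragment agree on its least identity number. -/
noncomputable def identify (L : ℕ) : List Round :=
  (minimum fun x => (x.ident : WithTop ℕ)).steps L
    fun x o => { x with fid := (o.getD ⊤).untopD 0 }

/-- The vertices find out whether their fragment has diameter at most `D`: an aggregation of `D`
rounds is complete at the vertices that have no vertex of the fragment at a larger distance. -/
noncomputable def probe (L D : ℕ) : List Round :=
  ((minimum fun x => (x.ident : WithTop ℕ)).steps D fun x o => { x with small := o.isSome }) ++
  (minimum fun x => if x.small then (1 : WithTop ℕ) else 0).steps L
    fun x o => { x with active := decide (o = some 1) }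

/-- Every vertex tells its neighbours the identity of its fragment. -/
noncomputable def announce : Round :=
  exchange (fun x _ => some (numMessage x.fid))
    fun x m => { x with nfid := fun i => (m i).elim 0 fun m => m.nums.headD 0 }

open Classical in
/-- Every active fragment chooses a minimum weight outgoing edge. -/
noncomputable def choose (L : ℕ) : List Round :=
  Aggregation.steps ⟨fun x => x.tree, bestEdge⟩ L fun x o =>
    { x with
      active := decide (x.active = true ∧ o ≠ some ⊤)
      out := fun j => decide (x.active = true ∧ FirstPort (fun i => x.nfid i ≠ x.fid ∧
        o = some ((toLex (x.weight i, x.ident) : ℝ ×ₗ ℕ) : WithTop (ℝ ×ₗ ℕ))) j)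
      color := x.fid
      matched := decide (¬ (x.active = true ∧ o ≠ some ⊤))
      accepted := false }

/-- The other ends of the chosen edges are informed. -/
noncomputable def mark : Round :=
  exchange (fun x i => if x.out i then some token else none)
    fun x m => { x with inn := fun i => (m i).isSome }

/-- One step of deterministic coin tossing along the chosen edges. -/
noncomputable def tossCoins (L : ℕ) : List Round :=
  exchange (fun x i => if x.inn i then some (numMessage x.color) else none)
    (fun x m => { x with
      report := (Finset.univ.filter fun i => x.out i = true).inf
        fun i => (m i).elim ⊤ MessageCode.dec }) ::
  (minimum fun x => x.report).steps L fun x o =>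
    { x with color := (o.getD ⊤).recTopCoe (recolorRoot x.color) fun n => recolor x.color n }

open Classical in
/-- The unmatched active fragments of colour `a` propose, along their chosen edges, to be matched;
every unmatched active fragment that receives proposals accepts one of them. -/
noncomputable def propose (L a : ℕ) : List Round :=
  exchange (fun x i => if x.out i = true ∧ x.matched = false ∧ x.color = a then some token
      else none)
    (fun x m => { x with
      proposed := fun i => (m i).isSome
      report := if x.matched = false ∧ ∃ i, (m i).isSome = true then x.ident else ⊤ }) ::
  ((minimum fun x => x.report).steps L fun x o =>
    { x with
      accepting := fun i => decide (o = some (x.ident : WithTop ℕ) ∧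
        FirstPort (fun j => x.proposed j = true) i)
      matched := decide (x.matched = true ∨ o ≠ some ⊤) }) ++
  exchange (fun x i => if x.accepting i then some token else none)
    (fun x m => { x with
      report := if ∃ i, x.out i = true ∧ (m i).isSome = true then 0 else ⊤ }) ::
  ((minimum fun x => x.report).steps L fun x o =>
    { x with
      matched := decide (x.matched = true ∨ o = some 0)
      accepted := decide (x.accepted = true ∨ o = some 0) })

/-- The chosen edges along which fragments merge are added to the forest. -/
noncomputable def merge : Round :=
  exchange (fun x i => if x.out i = true ∧ (x.accepted = true ∨ x.matched = false) then some token
      else none)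
    fun x m => { x with
      tree := fun i => decide (x.tree i = true ∨ (m i).isSome = true ∨
        (x.out i = true ∧ (x.accepted = true ∨ x.matched = false))) }

/-- Phase `i`, with `s` steps of deterministic coin tossing. The fragments have diameter at most
`6 * 2 ^ i`. -/
noncomputable def phase (s i : ℕ) : List Round :=
  identify (6 * 2 ^ i) ++ probe (6 * 2 ^ i) (2 ^ i) ++ [announce] ++ choose (6 * 2 ^ i) ++ [mark] ++
  (List.range s).flatMap (fun _ => tossCoins (6 * 2 ^ i)) ++
  (List.range 8).flatMap (fun a => propose (6 * 2 ^ i) a) ++ [merge]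

theorem length_phase_le (s i : ℕ) : (phase s i).length ≤ (154 + 8 * s) * 2 ^ i := by
  have h : 1 ≤ 2 ^ i := Nat.one_le_two_pow
  have h2 : s ≤ s * 2 ^ i := Nat.le_mul_of_pos_right s h
  simp only [phase, identify, probe, choose, tossCoins, propose, List.length_append,
    Aggregation.length_steps, List.length_cons, List.length_nil, List.length_flatMap,
    List.map_const', List.sum_replicate, List.length_range, smul_eq_mul]
  ring_nf
  ring_nf at h2
  omega

end Schedule

/-! ### Matching along the chosen edges -/

/-- A matching along the edges from `F` to `tgt F`, for active `F`: `add F` means that `F` is matched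
with `tgt F`, and `mat F` that `F` is matched or inactive. All edges that start at a fragment of a
colour below `a` have an end with `mat`. -/
structure IsGreedyMatching {Q : Type*} (act : Q → Prop) (tgt : Q → Q) (col : Q → ℕ) (a : ℕ)
    (mat add : Q → Prop) : Prop where
  of_inactive : ∀ F, ¬ act F → mat F
  of_add : ∀ F, add F → act F ∧ mat F ∧ act (tgt F) ∧ mat (tgt F)
  partner : ∀ F, act F → mat F → add F ∨ ∃ F', add F' ∧ tgt F' = F
  inj : ∀ F F', add F → add F' → tgt F = tgt F' → F = F'
  no_chain : ∀ F F', add F → add F' → tgt F ≠ F'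
  maximal : ∀ F, act F → col F < a → mat F ∨ mat (tgt F)

/-- A round of proposals from the fragments of colour `a`, of which those in `A` are accepted. Since
colours differ along the edges, no fragment both proposes and accepts. -/
theorem IsGreedyMatching.step {Q : Type*} {act : Q → Prop} {tgt : Q → Q} {col : Q → ℕ} {a : ℕ}
    {mat add : Q → Prop} (h : IsGreedyMatching act tgt col a mat add)
    (hcol : ∀ F, act F → col F ≠ col (tgt F)) {A : Q → Prop}
    (h1 : ∀ F, A F → act F ∧ ¬ mat F ∧ col F = a ∧ ¬ mat (tgt F))
    (h2 : ∀ F, act F → ¬ mat F → col F = a → ¬ mat (tgt F) → ∃ F', A F' ∧ tgt F' = tgt F)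
    (h3 : ∀ F F', A F → A F' → tgt F = tgt F' → F = F') :
    IsGreedyMatching act tgt col (a + 1) (fun F => mat F ∨ A F ∨ ∃ F', A F' ∧ tgt F' = F)
      (fun F => add F ∨ A F) where
  of_inactive F hF := Or.inl (h.of_inactive F hF)
  of_add F hF := by
    rcases hF with hF | hF
    · obtain ⟨i1, i2, i3, i4⟩ := h.of_add F hF
      exact ⟨i1, Or.inl i2, i3, Or.inl i4⟩
    · obtain ⟨i1, i2, i3, i4⟩ := h1 F hF
      exact ⟨i1, Or.inr (Or.inl hF), by_contra fun hc => i4 (h.of_inactive _ hc),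
        Or.inr (Or.inr ⟨F, hF, rfl⟩)⟩
  partner F ha hF := by
    rcases hF with hF | hF | ⟨F', hF, rfl⟩
    · rcases h.partner F ha hF with hF | ⟨F', hF', rfl⟩
      · exact Or.inl (Or.inl hF)
      · exact Or.inr ⟨F', Or.inl hF', rfl⟩
    · exact Or.inl (Or.inr hF)
    · exact Or.inr ⟨F', Or.inr hF, rfl⟩
  inj F F' hF hF' he := by
    rcases hF with hF | hF <;> rcases hF' with hF' | hF'
    · exact h.inj F F' hF hF' he
    · exact absurd (he ▸ (h.of_add F hF).2.2.2) (h1 F' hF').2.2.2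
    · exact absurd (he ▸ (h.of_add F' hF').2.2.2) (h1 F hF).2.2.2
    · exact h3 F F' hF hF' he
  no_chain F F' hF hF' := by
    rintro rfl
    rcases hF with hF | hF <;> rcases hF' with hF' | hF'
    · exact h.no_chain F _ hF hF' rfl
    · exact (h1 _ hF').2.1 (h.of_add F hF).2.2.2
    · exact (h1 _ hF).2.2.2 (h.of_add _ hF').2.1
    · exact hcol F (h1 F hF).1 ((h1 F hF).2.2.1.trans (h1 _ hF').2.2.1.symm)
  maximal F ha hF := by
    rcases Nat.lt_succ_iff_lt_or_eq.1 hF with hF | hF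
    · exact (h.maximal F ha hF).imp Or.inl Or.inl
    · by_cases i1 : mat F
      · exact Or.inl (Or.inl i1)
      by_cases i2 : mat (tgt F)
      · exact Or.inr (Or.inl i2)
      exact Or.inr (Or.inr (Or.inr (h2 F ha i1 hF i2)))

namespace Network

variable {V : Type*} {net : Network V} {i : ℕ} {T H : SimpleGraph V}

/-- Two edges of a tree that connect the same two fragments are equal. -/
theorem edge_eq_of_isAcyclic (hT : T.IsAcyclic) (hHT : H ≤ T) {a b c d : V} (hab : T.Adj a b)
    (hcd : T.Adj c d) (hac : H.Reachable a c) (hbd : H.Reachable b d) (hn : ¬ H.Reachable a b) :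
    s(a, b) = s(c, d) := by
  by_contra hne
  have hbr := SimpleGraph.isAcyclic_iff_forall_adj_isBridge.1 hT hab
  rw [SimpleGraph.isBridge_iff] at hbr
  have hle : H ≤ T.deleteEdges {s(a, b)} := by
    intro x y hxy
    rw [SimpleGraph.deleteEdges_adj]
    refine ⟨hHT hxy, fun he => hn ?_⟩
    have : s(a, b) ∈ H.edgeSet := by
      rw [← Set.mem_singleton_iff.1 he]
      exact hxy
    exact SimpleGraph.Adj.reachable this
  refine hbr ((hac.mono hle).trans ((SimpleGraph.Adj.reachable ?_).trans (hbd.mono hle).symm))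
  rw [SimpleGraph.deleteEdges_adj]
  exact ⟨hcd, fun he => hne (Set.mem_singleton_iff.1 he).symm⟩

/-- The forest after a phase in which the matching given by `mat` and `add` has been computed. -/
def mergedForest (net : Network V) (i : ℕ) (H : SimpleGraph V)
    (src dst : H.ConnectedComponent → V) (mat add : H.ConnectedComponent → Prop) :
    SimpleGraph V where
  Adj x y := x ≠ y ∧ (H.Adj x y ∨
    ∃ F, net.IsActive i F ∧ (add F ∨ ¬ mat F) ∧ s(x, y) = s(src F, dst F))
  symm := ⟨fun x y h => ⟨h.1.symm, h.2.imp SimpleGraph.Adj.symm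
    fun ⟨F, h1, h2, h3⟩ => ⟨F, h1, h2, by rw [Sym2.eq_swap]; exact h3⟩⟩⟩
  loopless := ⟨fun _ h => h.1 rfl⟩

/-- When all colours have been treated, the matching is maximal, and merging is a phase of
Controlled-GHS. -/
theorem isPhase_mergedForest [Finite V] (hT : net.IsUniqueMST T) (hHT : H ≤ T)
    {src dst : H.ConnectedComponent → V}
    (hmw : ∀ F, net.IsActive i F → net.IsMWOE F (src F) (dst F))
    {col : H.ConnectedComponent → ℕ} {a : ℕ} {mat add : H.ConnectedComponent → Prop}
    (hm : IsGreedyMatching (net.IsActive i) (fun F => H.connectedComponentMk (dst F)) col a mat add)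
    (hcol : ∀ F, col F < a) : net.IsPhase i H (net.mergedForest i H src dst mat add) := by
  have htgt : ∀ F, net.IsActive i F → F ≠ H.connectedComponentMk (dst F) :=
    fun F hF he => (hmw F hF).1.2.1 he.symm
  refine ⟨src, dst,
    { verts := {F | net.IsActive i F ∧ mat F}
      Adj := fun F F' => (add F ∧ H.connectedComponentMk (dst F) = F') ∨
        (add F' ∧ H.connectedComponentMk (dst F') = F)
      adj_sub := ?_
      edge_vert := ?_
      symm := ⟨fun F F' h => h.symm⟩ }, hmw, ?_, ?_, ?_⟩
  · rintro F F' (⟨h, rfl⟩ | ⟨h, rfl⟩)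
    · obtain ⟨h1, -, h3, -⟩ := hm.of_add F h
      exact ⟨htgt F h1, h1, h3, Or.inl rfl⟩
    · obtain ⟨h1, -, h3, -⟩ := hm.of_add F' h
      exact ⟨(htgt F' h1).symm, h3, h1, Or.inr rfl⟩
  · rintro F F' (⟨h, rfl⟩ | ⟨h, rfl⟩)
    · obtain ⟨h1, h2, -, -⟩ := hm.of_add F h
      exact ⟨h1, h2⟩
    · obtain ⟨-, -, h3, h4⟩ := hm.of_add F' h
      exact ⟨h3, h4⟩
  · rintro F ⟨hF, hFm⟩
    rcases hm.partner F hF hFm with h | ⟨F', h, he⟩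
    · refine ⟨_, Or.inl ⟨h, rfl⟩, ?_⟩
      rintro F' (⟨-, rfl⟩ | ⟨h', he⟩)
      · rfl
      · exact absurd he (hm.no_chain F' F h' h)
    · refine ⟨F', Or.inr ⟨h, he⟩, ?_⟩
      rintro F'' (⟨h', -⟩ | ⟨h', he'⟩)
      · exact absurd he (hm.no_chain F' F h h')
      · exact hm.inj F'' F' h' h (he'.trans he.symm)
  · rintro F F' ⟨-, h1, h2, h | h⟩
    · have he : H.connectedComponentMk (dst F) = F' := h
      rcases hm.maximal F h1 (hcol F) with h3 | h3
      · exact Or.inl ⟨h1, h3⟩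
      · exact Or.inr ⟨h2, he ▸ h3⟩
    · have he : H.connectedComponentMk (dst F') = F := h
      rcases hm.maximal F' h2 (hcol F') with h3 | h3
      · exact Or.inr ⟨h2, h3⟩
      · exact Or.inl ⟨h1, he ▸ h3⟩
  · intro x y
    constructor
    · rintro ⟨-, h | ⟨F, hF, h1, h2⟩⟩
      · exact Or.inl h
      · refine Or.inr ⟨F, hF, ?_, h2⟩
        rcases h1 with h1 | h1
        · exact Or.inr (Or.inl ⟨h1, rfl⟩)
        · exact Or.inl fun h => h1 h.2
    · have hne : ∀ F, net.IsActive i F → s(x, y) = s(src F, dst F) → x ≠ y := by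
        intro F hF he
        have hadj := (hmw F hF).1.2.2.ne
        rcases Sym2.eq_iff.1 he with ⟨rfl, rfl⟩ | ⟨rfl, rfl⟩
        · exact hadj
        · exact hadj.symm
      rintro (h | ⟨F, hF, h1, h2⟩)
      · exact ⟨h.ne, Or.inl h⟩
      · refine ⟨hne F hF h2, Or.inr ?_⟩
        rcases h1 with h1 | h1 | ⟨h1, h3⟩
        · exact ⟨F, hF, Or.inr fun h => h1 ⟨hF, h⟩, h2⟩
        · exact ⟨F, hF, Or.inl h1.1, h2⟩
        · -- Both fragments chose an edge to the other one, which is the same edge.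
          obtain ⟨h4, -⟩ := hm.of_add _ h1
          refine ⟨_, h4, Or.inl h1, h2.trans ?_⟩
          have hw := hmw F hF
          have hw' := hmw _ h4
          rw [Sym2.eq_swap (a := src (H.connectedComponentMk (dst F)))]
          have e1 : H.connectedComponentMk (src F) = F := hw.1.1
          refine edge_eq_of_isAcyclic hT.1.1.2.isAcyclic hHT (hT.adj_of_isMWOE hw)
            (hT.adj_of_isMWOE hw').symm (SimpleGraph.ConnectedComponent.exact (e1.trans h3.symm))
            (SimpleGraph.ConnectedComponent.exact ?_) fun hr => htgt F hF ?_
          · exact hw'.1.1.symm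
          · rw [← SimpleGraph.ConnectedComponent.sound hr, e1]

end Network

/-! ### The effect of the parts of a phase -/

namespace Aggregation

variable {A : Type} [LinearOrder A] [OrderTop A] {V : Type*} [Fintype V] {H : SimpleGraph V}

theorem fragmentInf_eq {f : V → A} {v x : V} {b : A} (hx : H.Reachable v x) (he : f x = b)
    (h : ∀ y, H.Reachable v y → b ≤ f y) : fragmentInf H f v = b := by
  obtain ⟨y, hy, hfy⟩ := exists_fragmentInf_eq H f v
  exact le_antisymm (he ▸ fragmentInf_le hx) (hfy ▸ h y hy)

theorem fragmentInf_eq_top {f : V → A} {v : V} (h : ∀ y, H.Reachable v y → f y = ⊤) :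
    fragmentInf H f v = ⊤ :=
  fragmentInf_eq (SimpleGraph.Reachable.refl v) (h v (SimpleGraph.Reachable.refl v))
    fun y hy => (h y hy).ge

end Aggregation

namespace Network

variable {V : Type*} {net : Network V} {i N L : ℕ} {T H : SimpleGraph V}

/-- A message with at most one number, which is at most `4 * N`, and at most one weight. -/
def SmallMessage (net : Network V) (N : ℕ) (m : Message) : Prop :=
  m.nums.length ≤ 1 ∧ (∀ x ∈ m.nums, x ≤ 4 * N) ∧ m.weights.length ≤ 1 ∧
    ∀ x ∈ m.weights, ∃ e ∈ net.graph.edgeSet, net.weight e = x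

theorem smallMessage_token : net.SmallMessage N token := by
  simp [SmallMessage, token]

theorem smallMessage_num {n : ℕ} (h : n ≤ 4 * N) : net.SmallMessage N (numMessage n) := by
  simpa [SmallMessage, numMessage] using h

theorem smallMessage_enc {b : WithTop ℕ} (h : ∀ n : ℕ, b = n → n ≤ 4 * N) :
    net.SmallMessage N (MessageCode.enc b) := by
  cases b with
  | top => exact smallMessage_token
  | coe n => exact smallMessage_num (h n rfl)

/-- The vertices know their identity numbers, the weights of their incident edges, and which of these
edges belong to the forest `H`. -/
structure ForestState (net : Network V) (H : SimpleGraph V) (σ : net.Config Memory) : Prop where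
  ident : ∀ v, (σ v).ident = net.ident v
  weight : ∀ v j, (σ v).weight j = net.weight s(v, net.port v j)
  tree : ∀ v j, (σ v).tree j = true ↔ H.Adj v (net.port v j)

/-- The edge from `v` to `u` is the chosen edge of the fragment of `v`. -/
def ChosenEdge (net : Network V) (i : ℕ) (H : SimpleGraph V) (src dst : H.ConnectedComponent → V)
    (v u : V) : Prop :=
  net.IsActive i (H.connectedComponentMk v) ∧ v = src (H.connectedComponentMk v) ∧
    u = dst (H.connectedComponentMk v)

/-- The configurations between the choice of the edges `(src F, dst F)` and the merging: the
fragments have the colours `col`, and `mat` and `add` describe the matching. -/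
structure MatchingState (net : Network V) (i : ℕ) (H : SimpleGraph V)
    (src dst : H.ConnectedComponent → V) (col : H.ConnectedComponent → ℕ)
    (mat add : H.ConnectedComponent → Prop) (σ : net.Config Memory) : Prop
    extends net.ForestState H σ where
  out : ∀ v j, (σ v).out j = true ↔ net.ChosenEdge i H src dst v (net.port v j)
  inn : ∀ v j, (σ v).inn j = true ↔ net.ChosenEdge i H src dst (net.port v j) v
  color : ∀ v, (σ v).color = col (H.connectedComponentMk v)
  matched : ∀ v, (σ v).matched = true ↔ mat (H.connectedComponentMk v)
  accepted : ∀ v, (σ v).accepted = true ↔ add (H.connectedComponentMk v)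

theorem ChosenEdge.right_unique {src dst : H.ConnectedComponent → V} {v u u' : V}
    (h : net.ChosenEdge i H src dst v u) (h' : net.ChosenEdge i H src dst v u') : u = u' :=
  h.2.2.trans h'.2.2.symm

section

variable {src dst : H.ConnectedComponent → V}

theorem chosenEdge_src (hmw : ∀ F, net.IsActive i F → net.IsMWOE F (src F) (dst F))
    {F : H.ConnectedComponent} (hF : net.IsActive i F) :
    net.ChosenEdge i H src dst (src F) (dst F) := by
  have h : H.connectedComponentMk (src F) = F := (hmw F hF).1.1
  unfold ChosenEdge
  rw [h]
  exact ⟨hF, rfl, rfl⟩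

theorem ChosenEdge.adj (hmw : ∀ F, net.IsActive i F → net.IsMWOE F (src F) (dst F)) {v u : V}
    (h : net.ChosenEdge i H src dst v u) : net.graph.Adj v u := by
  have h1 := (hmw _ h.1).1.2.2
  rwa [← h.2.1, ← h.2.2] at h1

end

variable [Fintype V] {σ : net.Config Memory}

/-- The effect of an aggregation of numbers with enough rounds: every vertex learns the minimum over its
fragment. -/
theorem runs_minimum (hT : net.IsUniqueMST T) (hHT : H ≤ T)
    (hL : ∀ F : H.ConnectedComponent, FragmentDiamLE H F L) (hσ : net.ForestState H σ)
    {val : ∀ {d : ℕ}, Memory d → WithTop ℕ} (f : V → WithTop ℕ) (hf : ∀ v, val (σ v) = f v)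
    (hgood : ∀ v (n : ℕ), f v = n → n ≤ 4 * N)
    (store : ∀ {d : ℕ}, Memory d → Option (WithTop ℕ) → Memory d) :
    net.Runs (net.SmallMessage N) ((Schedule.minimum val).steps L store) (withBuffer σ)
      (withBuffer fun v => store (σ v) (some (Aggregation.fragmentInf H f v)))
      (2 * Fintype.card V) := by
  have h := Aggregation.runs_steps (a := Schedule.minimum val) (good := net.SmallMessage N)
    hT.1.1.2 hHT (hHT.trans hT.1.1.1) hσ.tree f hf (fun v => smallMessage_enc (hgood v)) L store
  simpa only [Aggregation.outcomeAfter_of_diam hL] using h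

/-- Every vertex sends at most one of the messages `P`, or every vertex receives at most one. -/
def AtMostOneMessage (P : V → V → Prop) : Prop :=
  (∀ v u u', P v u → P v u' → u = u') ∨ ∀ v v' u, P v u → P v' u → v = v'

open Classical in
/-- The effect of a round in which `v` sends the message `g v` to `u` if `P v u`. -/
theorem runs_exchange_if {send : ∀ {d : ℕ}, Memory d → Fin d → Option Message}
    {recv : ∀ {d : ℕ}, Memory d → (Fin d → Option Message) → Memory d} {good : Message → Prop}
    (P : V → V → Prop) (g : V → Message)
    (hP : ∀ v j, (P v (net.port v j) → send (σ v) j = some (g v)) ∧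
      (¬ P v (net.port v j) → send (σ v) j = none))
    (hM : AtMostOneMessage P) (hgood : ∀ v u, P v u → good (g v)) :
    net.Runs good [exchange send recv] (withBuffer σ)
      (withBuffer fun v => recv (σ v) fun j => if P (net.port v j) v then some (g (net.port v j))
        else none) (Fintype.card V) := by
  refine runs_exchange (fun v u => if P v u then some (g v) else none) (fun v j => ?_) ?_ ?_
  · split_ifs with h
    · exact (hP v j).1 h
    · exact (hP v j).2 h
  · refine le_trans (le_of_eq ?_) (hM.elim (net.sum_ports_le_card_of_right_unique P)
      (net.sum_ports_le_card_of_left_unique P))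
    refine Finset.sum_congr rfl fun v _ => Finset.sum_congr rfl fun j _ => ?_
    split_ifs <;> simp_all
  · intro v u m hm
    split_ifs at hm with h
    exact Option.some.inj hm ▸ hgood v u h

theorem natCast_withTop_inj {m n : ℕ} (h : (m : WithTop ℕ) = n) : m = n := Nat.cast_injective h

variable {src dst : H.ConnectedComponent → V} {col : H.ConnectedComponent → ℕ}
  {mat add : H.ConnectedComponent → Prop}

open Classical in
/-- The colours after a step of deterministic coin tossing. -/
noncomputable def newColor (net : Network V) (i : ℕ) (H : SimpleGraph V)
    (dst : H.ConnectedComponent → V) (col : H.ConnectedComponent → ℕ) (F : H.ConnectedComponent) :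
    ℕ :=
  if net.IsActive i F then recolor (col F) (col (H.connectedComponentMk (dst F)))
  else recolorRoot (col F)

theorem runs_tossCoins (hT : net.IsUniqueMST T) (hHT : H ≤ T)
    (hL : ∀ F : H.ConnectedComponent, FragmentDiamLE H F L)
    (hmw : ∀ F, net.IsActive i F → net.IsMWOE F (src F) (dst F))
    (hσ : net.MatchingState i H src dst col mat add σ) (hcol : ∀ F, col F ≤ 4 * N) :
    ∃ τ, net.Runs (net.SmallMessage N) (Schedule.tossCoins L) (withBuffer σ) (withBuffer τ)
      (3 * Fintype.card V) ∧
      net.MatchingState i H src dst (net.newColor i H dst col) mat add τ := by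
  classical
  let f : V → WithTop ℕ := fun v =>
    if net.IsActive i (H.connectedComponentMk v) ∧ v = src (H.connectedComponentMk v) then
      ((col (H.connectedComponentMk (dst (H.connectedComponentMk v))) : ℕ) : WithTop ℕ) else ⊤
  have h1 := runs_exchange_if (σ := σ) (good := net.SmallMessage N)
    (send := fun x i => if x.inn i then some (numMessage x.color) else none)
    (recv := fun x m => { x with
      report := (Finset.univ.filter fun i => x.out i = true).inf
        fun i => (m i).elim ⊤ MessageCode.dec })
    (fun v u => net.ChosenEdge i H src dst u v)
    (fun v => numMessage (col (H.connectedComponentMk v)))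
    (fun v j => by
      simp only [hσ.inn, hσ.color]
      exact ⟨fun h => if_pos h, fun h => if_neg h⟩)
    (Or.inr fun v v' u h h' => h.right_unique h')
    (fun v u _ => smallMessage_num (hcol _))
  have hrep : ∀ v, ((Finset.univ.filter fun j => (σ v).out j = true).inf fun j =>
      Option.elim (if net.ChosenEdge i H src dst v (net.port v j) then
        some (numMessage (col (H.connectedComponentMk (net.port v j)))) else none) ⊤
        (MessageCode.dec (A := WithTop ℕ))) = f v := by
    intro v
    by_cases hv : net.IsActive i (H.connectedComponentMk v) ∧ v = src (H.connectedComponentMk v)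
    · have hc : net.ChosenEdge i H src dst v (dst (H.connectedComponentMk v)) := ⟨hv.1, hv.2, rfl⟩
      have hp : (net.port v ((net.port v).symm ⟨_, hc.adj hmw⟩) : V)
          = dst (H.connectedComponentMk v) := by rw [Equiv.apply_symm_apply]
      set j := (net.port v).symm ⟨_, hc.adj hmw⟩
      have hfil : (Finset.univ.filter fun j => (σ v).out j = true) = {j} := by
        ext l
        simp only [Finset.mem_filter, Finset.mem_univ, true_and, Finset.mem_singleton, hσ.out]
        constructor
        · intro hl
          exact (net.port v).injective (Subtype.ext ((hl.right_unique hc).trans hp.symm))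
        · rintro rfl
          rw [hp]
          exact hc
      rw [hfil, Finset.inf_singleton, hp, if_pos hc]
      simp only [f, if_pos hv]
      rfl
    · have hfil : (Finset.univ.filter fun j => (σ v).out j = true) = ∅ := by
        ext l
        simp only [Finset.mem_filter, Finset.mem_univ, true_and, hσ.out, Finset.notMem_empty,
          iff_false]
        exact fun h => hv ⟨h.1, h.2.1⟩
      rw [hfil, Finset.inf_empty]
      simp only [f, if_neg hv]
  have hinf : ∀ v, Aggregation.fragmentInf H f v =
      if net.IsActive i (H.connectedComponentMk v) then
        ((col (H.connectedComponentMk (dst (H.connectedComponentMk v))) : ℕ) : WithTop ℕ)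
      else ⊤ := by
    intro v
    split_ifs with hv
    · have he : H.connectedComponentMk (src (H.connectedComponentMk v))
          = H.connectedComponentMk v := (hmw _ hv).1.1
      refine Aggregation.fragmentInf_eq (x := src (H.connectedComponentMk v))
        (SimpleGraph.ConnectedComponent.exact he.symm) ?_ ?_
      · simp only [f, he, and_true, if_pos hv]
      · intro y hy
        simp only [f, ← SimpleGraph.ConnectedComponent.sound hy]
        split_ifs
        · exact le_rfl
        · exact le_top
    · refine Aggregation.fragmentInf_eq_top fun y hy => ?_
      simp only [f, ← SimpleGraph.ConnectedComponent.sound hy, hv, false_and, if_false]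
  have h2 := h1.append (runs_minimum (N := N) (val := fun x => x.report) hT hHT hL
    (by exact ⟨hσ.ident, hσ.weight, hσ.tree⟩) f (by exact hrep) (by
      intro v n hn
      simp only [f] at hn
      split_ifs at hn with hv
      · rw [← natCast_withTop_inj hn]
        exact hcol _
      · exact absurd hn.symm (WithTop.natCast_ne_top n))
    fun x o => { x with
      color := (o.getD ⊤).recTopCoe (recolorRoot x.color) fun n => recolor x.color n })
  refine ⟨_, h2.mono (by omega), ⟨hσ.ident, hσ.weight, hσ.tree⟩, hσ.out, hσ.inn, fun v => ?_,
    hσ.matched, hσ.accepted⟩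
  dsimp only
  rw [hinf, hσ.color]
  unfold newColor
  split_ifs <;> rfl

/-- The effect of one round of proposals: the set `A` of fragments whose proposals are accepted. -/
theorem runs_propose (hT : net.IsUniqueMST T) (hHT : H ≤ T)
    (hL : ∀ F : H.ConnectedComponent, FragmentDiamLE H F L)
    (hid : ∀ v, net.ident v < N)
    (hmw : ∀ F, net.IsActive i F → net.IsMWOE F (src F) (dst F))
    (hσ : net.MatchingState i H src dst col mat add σ) (a : ℕ) :
    ∃ (τ : net.Config Memory) (A : H.ConnectedComponent → Prop),
      net.Runs (net.SmallMessage N) (Schedule.propose L a) (withBuffer σ) (withBuffer τ)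
        (6 * Fintype.card V) ∧
      net.MatchingState i H src dst col
        (fun F => mat F ∨ A F ∨ ∃ F', A F' ∧ H.connectedComponentMk (dst F') = F)
        (fun F => add F ∨ A F) τ ∧
      (∀ F, A F → net.IsActive i F ∧ ¬ mat F ∧ col F = a ∧ ¬ mat (H.connectedComponentMk (dst F))) ∧
      (∀ F, net.IsActive i F → ¬ mat F → col F = a → ¬ mat (H.connectedComponentMk (dst F)) →
        ∃ F', A F' ∧ H.connectedComponentMk (dst F') = H.connectedComponentMk (dst F)) ∧
      (∀ F F', A F → A F' → H.connectedComponentMk (dst F) = H.connectedComponentMk (dst F') →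
        F = F') := by
  classical
  let c : V → H.ConnectedComponent := H.connectedComponentMk
  -- `v` proposes to `u`.
  obtain ⟨P, hPdef⟩ : ∃ P : V → V → Prop, ∀ v u, P v u ↔
      net.ChosenEdge i H src dst v u ∧ ¬ mat (c v) ∧ col (c v) = a := ⟨_, fun _ _ => Iff.rfl⟩
  let f : V → WithTop ℕ := fun u => if ¬ mat (c u) ∧ ∃ w, P w u then (net.ident u : WithTop ℕ) else ⊤
  let o : V → WithTop ℕ := Aggregation.fragmentInf H f
  -- `u` accepts the proposal of `w`.
  obtain ⟨Acc, hAccdef⟩ : ∃ Acc : V → V → Prop, ∀ u w, Acc u w ↔ o u = net.ident u ∧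
      ∃ j, (net.port u j : V) = w ∧ FirstPort (fun l => P (net.port u l) u) j :=
    ⟨_, fun _ _ => Iff.rfl⟩
  let A : H.ConnectedComponent → Prop := fun F => net.IsActive i F ∧ Acc (dst F) (src F)
  let g : V → WithTop ℕ := fun v => if ∃ u, net.ChosenEdge i H src dst v u ∧ Acc u v then 0 else ⊤
  have hmat : ∀ v, (σ v).matched = false ↔ ¬ mat (c v) := fun v => by
    rw [← hσ.matched v, Bool.not_eq_true]
  have hexP : ∀ u, (∃ j, P (net.port u j) u) ↔ ∃ w, P w u := by
    intro u
    constructor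
    · rintro ⟨j, hj⟩
      exact ⟨_, hj⟩
    · rintro ⟨w, hw⟩
      refine ⟨(net.port u).symm ⟨w, (((hPdef w u).1 hw).1.adj hmw).symm⟩, ?_⟩
      rw [Equiv.apply_symm_apply]
      exact hw
  have hAccP : ∀ {u w}, Acc u w → P w u := by
    intro u w h
    obtain ⟨-, j, rfl, hj⟩ := (hAccdef u w).1 h
    exact hj.1
  have ho : ∀ {u w}, c u = c w → o u = o w := fun h =>
    Aggregation.fragmentInf_congr (SimpleGraph.ConnectedComponent.exact h)
  have hof : ∀ u, ∃ w, c w = c u ∧ o u = f w := by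
    intro u
    obtain ⟨w, hw, he⟩ := Aggregation.exists_fragmentInf_eq H f u
    exact ⟨w, (SimpleGraph.ConnectedComponent.sound hw).symm, he⟩
  have hfn : ∀ {u} {n : ℕ}, f u = n → n = net.ident u ∧ ¬ mat (c u) ∧ ∃ w, P w u := by
    intro u n hn
    simp only [f] at hn
    split_ifs at hn with h
    · exact ⟨(natCast_withTop_inj hn).symm, h⟩
    · exact absurd hn.symm (WithTop.natCast_ne_top n)
  have hown : ∀ {u}, o u = net.ident u → ¬ mat (c u) := by
    intro u hu
    obtain ⟨w, hw, he⟩ := hof u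
    have := (hfn (he.symm.trans hu)).2.1
    rwa [hw] at this
  have hChosenA : ∀ {v u}, net.ChosenEdge i H src dst v u → Acc u v → A (c v) := by
    rintro v u ⟨h1, h2, h3⟩ h
    refine ⟨h1, ?_⟩
    rw [← h2, ← h3]
    exact h
  have hotop : ∀ u, o u ≠ ⊤ ↔ ∃ F, A F ∧ c (dst F) = c u := by
    intro u
    constructor
    · intro h
      obtain ⟨w, hw, he⟩ := hof u
      obtain ⟨n, hn⟩ : ∃ n : ℕ, (n : WithTop ℕ) = o u := WithTop.ne_top_iff_exists.1 h
      obtain ⟨h1, h2, h3⟩ := hfn (he.symm.trans hn.symm)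
      obtain ⟨j, hj⟩ := exists_firstPort ((hexP w).2 h3)
      have hAcc : Acc w (net.port w j) :=
        (hAccdef _ _).2 ⟨by rw [ho hw, ← hn, h1], j, rfl, hj⟩
      have hP := (hPdef _ _).1 (hAccP hAcc)
      refine ⟨_, hChosenA hP.1 hAcc, ?_⟩
      have h4 : w = dst (c (net.port w j)) := hP.1.2.2
      rw [← h4, hw]
    · rintro ⟨F, hF, he⟩
      rw [← ho he, ((hAccdef _ _).1 hF.2).1]
      exact WithTop.natCast_ne_top _
  have hg : ∀ v, (∃ u, net.ChosenEdge i H src dst v u ∧ Acc u v) → A (c v) :=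
    fun v ⟨u, h1, h2⟩ => hChosenA h1 h2
  have hginf : ∀ v, Aggregation.fragmentInf H g v = 0 ↔ A (c v) := by
    intro v
    constructor
    · intro h
      obtain ⟨w, hw, he⟩ := Aggregation.exists_fragmentInf_eq H g v
      rw [h] at he
      simp only [g] at he
      split_ifs at he with h1
      · have := hg w h1
        rwa [← show c v = c w from SimpleGraph.ConnectedComponent.sound hw] at this
      · exact absurd he (by simp)
    · intro h
      have he : c (src (c v)) = c v := (hmw _ h.1).1.1
      refine Aggregation.fragmentInf_eq (x := src (c v))
        (SimpleGraph.ConnectedComponent.exact he.symm) ?_ fun y _ => zero_le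
      simp only [g]
      rw [if_pos ⟨dst (c v), chosenEdge_src hmw h.1, h.2⟩]
  have hbound : ∀ v, net.ident v ≤ 4 * N := fun v => by
    have := hid v
    omega
  have h1 := runs_exchange_if (σ := σ) (good := net.SmallMessage N)
    (send := fun x i => if x.out i = true ∧ x.matched = false ∧ x.color = a then some token
      else none)
    (recv := fun x m => { x with
      proposed := fun i => (m i).isSome
      report := if x.matched = false ∧ ∃ i, (m i).isSome = true then (x.ident : WithTop ℕ) else ⊤ })
    P (fun _ => token)
    (fun v j => by
      simp only [hσ.out, hσ.color, hmat]
      rw [hPdef]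
      exact ⟨fun h => if_pos h, fun h => if_neg h⟩)
    (Or.inl fun v u u' h h' => ((hPdef _ _).1 h).1.right_unique ((hPdef _ _).1 h').1)
    (fun v u _ => smallMessage_token)
  have h2 := h1.append (runs_minimum (N := N) (val := fun x => x.report) hT hHT hL
    (by exact ⟨hσ.ident, hσ.weight, hσ.tree⟩) f
    (by
      intro v
      simp only [f, ← hexP, hmat, hσ.ident]
      congr 1
      simp only [eq_iff_iff]
      refine and_congr Iff.rfl (exists_congr fun j => ?_)
      split_ifs with h <;> simp [h])
    (by
      intro v n hn
      rw [(hfn hn).1]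
      exact hbound v)
    fun x o => { x with
      accepting := fun i => decide (o = some (x.ident : WithTop ℕ) ∧
        FirstPort (fun j => x.proposed j = true) i)
      matched := decide (x.matched = true ∨ o ≠ some ⊤) })
  have hisSome : ∀ (p : Prop) [Decidable p], (if p then some token else none).isSome = true ↔ p := by
    intro p _
    split_ifs with h <;> simp [h]
  have hacc : ∀ v j, (some (o v) = some (net.ident v : WithTop ℕ) ∧
      FirstPort (fun l => (if P (net.port v l) v then some token else none).isSome = true) j) ↔
      Acc v (net.port v j) := by
    intro v j
    simp only [hisSome, Option.some.injEq, hAccdef]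
    refine and_congr Iff.rfl ⟨fun h => ⟨j, rfl, h⟩, ?_⟩
    rintro ⟨l, hl, h⟩
    rwa [← (net.port v).injective (Subtype.ext hl)]
  have h3 := h2.append (runs_exchange_if (good := net.SmallMessage N)
    (send := fun x i => if x.accepting i then some token else none)
    (recv := fun x m => { x with
      report := if ∃ i, x.out i = true ∧ (m i).isSome = true then 0 else ⊤ })
    Acc (fun _ => token)
    (fun v j => by
      simp only [decide_eq_true_iff, hσ.ident, ← hacc]
      exact ⟨fun h => if_pos h, fun h => if_neg h⟩)
    (Or.inl (by
      intro v u u' h h'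
      obtain ⟨-, j, rfl, hj⟩ := (hAccdef _ _).1 h
      obtain ⟨-, j', rfl, hj'⟩ := (hAccdef _ _).1 h'
      rw [hj.unique hj']))
    (fun v u _ => smallMessage_token))
  have h4 := h3.append (runs_minimum (N := N) (val := fun x => x.report) hT hHT hL
    (by exact ⟨hσ.ident, hσ.weight, hσ.tree⟩) g
    (by
      intro v
      simp only [g, hσ.out]
      congr 1
      simp only [eq_iff_iff]
      constructor
      · rintro ⟨j, hj, hj'⟩
        exact ⟨_, hj, (hisSome _).1 hj'⟩
      · rintro ⟨u, hu, hu'⟩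
        refine ⟨(net.port v).symm ⟨u, hu.adj hmw⟩, ?_⟩
        rw [hisSome, Equiv.apply_symm_apply]
        exact ⟨hu, hu'⟩)
    (by
      intro v n hn
      simp only [g] at hn
      split_ifs at hn
      · have : 0 = n := natCast_withTop_inj (by simpa using hn)
        omega
      · exact absurd hn.symm (WithTop.natCast_ne_top n))
    fun x o => { x with
      matched := decide (x.matched = true ∨ o = some 0)
      accepted := decide (x.accepted = true ∨ o = some 0) })
  have h5 := h4.mono (M' := 6 * Fintype.card V) (by omega)
  rw [List.append_assoc _ [_]] at h5
  refine ⟨_, A, h5, ⟨⟨hσ.ident, hσ.weight, hσ.tree⟩, hσ.out, hσ.inn, hσ.color, fun v => ?_,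
    fun v => ?_⟩, ?_, ?_, ?_⟩
  · simp only [decide_eq_true_iff, Option.some.injEq, hginf, hσ.matched, ne_eq]
    have := hotop v
    simp only [o, ne_eq] at this
    rw [this, or_assoc, or_comm (a := A _)]
  · simp only [decide_eq_true_iff, Option.some.injEq, hginf, hσ.accepted, c]
  · intro F hF
    have hP := (hPdef _ _).1 (hAccP hF.2)
    have he : c (src F) = F := (hmw F hF.1).1.1
    refine ⟨hF.1, ?_, ?_, hown ((hAccdef _ _).1 hF.2).1⟩
    · rw [← he]
      exact hP.2.1
    · rw [← he]
      exact hP.2.2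
  · intro F hF hm ha hm'
    have he : c (src F) = F := (hmw F hF).1.1
    have hP : P (src F) (dst F) :=
      (hPdef _ _).2 ⟨chosenEdge_src hmw hF, by rwa [he], by rwa [he]⟩
    refine (hotop (dst F)).1 fun h => ?_
    have h5 : o (dst F) ≤ f (dst F) :=
      Aggregation.fragmentInf_le (SimpleGraph.Reachable.refl _)
    rw [h, top_le_iff] at h5
    simp only [f] at h5
    rw [if_pos ⟨hm', _, hP⟩] at h5
    exact WithTop.natCast_ne_top _ h5
  · intro F F' hF hF' he
    have h5 : net.ident (dst F) = net.ident (dst F') :=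
      natCast_withTop_inj
        (((hAccdef _ _).1 hF.2).1.symm.trans ((ho he).trans ((hAccdef _ _).1 hF'.2).1))
    have h6 := net.ident_injective h5
    obtain ⟨-, j, hj, hj1⟩ := (hAccdef _ _).1 hF.2
    obtain ⟨-, j', hj', hj1'⟩ := (hAccdef _ _).1 hF'.2
    rw [← show c (src F) = F from (hmw F hF.1).1.1, ← show c (src F') = F' from (hmw F' hF'.1).1.1,
      ← hj, ← hj']
    clear hj hj'
    revert j j'
    rw [h6]
    intro j hj j' hj'
    rw [hj.unique hj']

theorem runs_merge
    (hmw : ∀ F, net.IsActive i F → net.IsMWOE F (src F) (dst F))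
    (hσ : net.MatchingState i H src dst col mat add σ) :
    ∃ τ, net.Runs (net.SmallMessage N) [Schedule.merge] (withBuffer σ) (withBuffer τ)
      (Fintype.card V) ∧ net.ForestState (net.mergedForest i H src dst mat add) τ := by
  classical
  let c : V → H.ConnectedComponent := H.connectedComponentMk
  let P : V → V → Prop := fun v u =>
    net.ChosenEdge i H src dst v u ∧ (add (c v) ∨ ¬ mat (c v))
  have hmat : ∀ v, (σ v).matched = false ↔ ¬ mat (c v) := fun v => by
    rw [← hσ.matched v, Bool.not_eq_true]
  refine ⟨_, runs_exchange_if P (fun _ => token)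
    (fun v j => by
      simp only [hσ.out, hσ.accepted, hmat]
      exact ⟨fun h => if_pos h, fun h => if_neg h⟩)
    (Or.inl fun v u u' h h' => h.1.right_unique h'.1)
    (fun v u _ => smallMessage_token), hσ.ident, hσ.weight, fun v j => ?_⟩
  have hisSome : ∀ (p : Prop) [Decidable p], (if p then some token else none).isSome = true ↔ p := by
    intro p _
    split_ifs with h <;> simp [h]
  simp only [decide_eq_true_iff, hisSome, hσ.tree, hσ.out, hσ.accepted, hmat]
  have hPF : ∀ {v u}, P v u → ∃ F, net.IsActive i F ∧ (add F ∨ ¬ mat F) ∧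
      s(v, u) = s(src F, dst F) := by
    intro v u h
    exact ⟨c v, h.1.1, h.2, by rw [← h.1.2.1, ← h.1.2.2]⟩
  constructor
  · intro h
    refine ⟨(net.port v j).2.ne, ?_⟩
    rcases h with h | h | h
    · exact Or.inl h
    · obtain ⟨F, h1, h2, h3⟩ := hPF h
      exact Or.inr ⟨F, h1, h2, by rw [← h3, Sym2.eq_swap]⟩
    · exact Or.inr (hPF h)
  · rintro ⟨-, h | ⟨F, h1, h2, h3⟩⟩
    · exact Or.inl h
    · have he : c (src F) = F := (hmw F h1).1.1
      have hP : P (src F) (dst F) := ⟨chosenEdge_src hmw h1, by rwa [he]⟩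
      rcases Sym2.eq_iff.1 h3 with ⟨h4, h5⟩ | ⟨h4, h5⟩
      · rw [← h4, ← h5] at hP
        exact Or.inr (Or.inr hP)
      · rw [← h4, ← h5] at hP
        exact Or.inr (Or.inl hP)

end Network

/-! ### The choice of outgoing edges, and the effect of a phase -/

namespace Network

variable {V : Type*} [Fintype V] {net : Network V} {i N L : ℕ} {T H : SimpleGraph V}
  {σ : net.Config Memory}

/-- The least identity number in the fragment of `v`. -/
noncomputable def fragmentIdent (net : Network V) (H : SimpleGraph V) (v : V) : ℕ :=
  (Aggregation.fragmentInf H (fun w => (net.ident w : WithTop ℕ)) v).untopD 0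

theorem exists_fragmentIdent_eq (net : Network V) (H : SimpleGraph V) (v : V) :
    ∃ w, H.Reachable v w ∧ net.fragmentIdent H v = net.ident w := by
  obtain ⟨w, hw, he⟩ := Aggregation.exists_fragmentInf_eq H (fun w => (net.ident w : WithTop ℕ)) v
  refine ⟨w, hw, ?_⟩
  rw [fragmentIdent, he]
  rfl

theorem fragmentIdent_eq_iff {v w : V} :
    net.fragmentIdent H v = net.fragmentIdent H w ↔ H.Reachable v w := by
  constructor
  · intro h
    obtain ⟨a, ha, ha'⟩ := net.exists_fragmentIdent_eq H v
    obtain ⟨b, hb, hb'⟩ := net.exists_fragmentIdent_eq H w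
    have : a = b := net.ident_injective (by rw [← ha', ← hb', h])
    subst this
    exact ha.trans hb.symm
  · intro h
    rw [fragmentIdent, fragmentIdent, Aggregation.fragmentInf_congr h]

theorem runs_identify (hT : net.IsUniqueMST T) (hHT : H ≤ T)
    (hL : ∀ F : H.ConnectedComponent, FragmentDiamLE H F L) (hid : ∀ v, net.ident v < N)
    (hσ : net.ForestState H σ) :
    net.Runs (net.SmallMessage N) (Schedule.identify L) (withBuffer σ)
      (withBuffer fun v => { σ v with fid := net.fragmentIdent H v }) (2 * Fintype.card V) :=
  runs_minimum hT hHT hL hσ (fun v => (net.ident v : WithTop ℕ)) (fun v => by rw [hσ.ident])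
    (fun v n hn => by
      rw [← natCast_withTop_inj hn]
      have := hid v
      omega) _

open Classical in
/-- After the probe, the vertices of a fragment know whether its diameter is at most `D`. -/
theorem runs_probe (hT : net.IsUniqueMST T) (hHT : H ≤ T)
    (hL : ∀ F : H.ConnectedComponent, FragmentDiamLE H F L) (hid : ∀ v, net.ident v < N)
    (hσ : net.ForestState H σ) (D : ℕ) (hN : 1 ≤ N) :
    ∃ small : V → Bool, net.Runs (net.SmallMessage N) (Schedule.probe L D) (withBuffer σ)
      (withBuffer fun v => { σ v with
        small := small v
        active := decide (FragmentDiamLE H (H.connectedComponentMk v) D) })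
      (4 * Fintype.card V) := by
  let f : V → WithTop ℕ := fun v => if ∀ x, H.Reachable v x → H.dist v x ≤ D then 1 else 0
  have h1 := Aggregation.runs_steps (σ := σ)
    (a := Schedule.minimum fun x => (x.ident : WithTop ℕ))
    (good := net.SmallMessage N) hT.1.1.2 hHT (hHT.trans hT.1.1.1) hσ.tree
    (fun v => (net.ident v : WithTop ℕ)) (fun v => by
      simp only [Schedule.minimum]
      rw [hσ.ident]) (fun v => smallMessage_enc fun n hn => by
        rw [← natCast_withTop_inj hn]
        have := hid v
        omega) D fun x o => { x with small := o.isSome }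
  have h2 := h1.append (runs_minimum (N := N)
    (val := fun x => if x.small then (1 : WithTop ℕ) else 0) hT hHT hL
    (by exact ⟨hσ.ident, hσ.weight, hσ.tree⟩) f
    (by
      intro v
      simp only [f, Aggregation.outcomeAfter]
      split_ifs <;> simp_all)
    (by
      intro v n hn
      have : n ≤ 1 := by
        simp only [f] at hn
        split_ifs at hn
        · exact (natCast_withTop_inj (m := 1) (by simpa using hn)).ge
        · exact (natCast_withTop_inj (m := 0) (by simpa using hn)).ge.trans zero_le_one
      omega)
    fun x o => { x with active := decide (o = some 1) })
  have hinf : ∀ v, Aggregation.fragmentInf H f v = 1 ↔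
      FragmentDiamLE H (H.connectedComponentMk v) D := by
    intro v
    constructor
    · intro h x hx y hy
      have hvx : H.Reachable v x := (SimpleGraph.ConnectedComponent.exact hx).symm
      have hfx : (1 : WithTop ℕ) ≤ f x := h ▸ Aggregation.fragmentInf_le hvx
      have hcond : ∀ z, H.Reachable x z → H.dist x z ≤ D := by
        by_contra hc
        simp only [f, if_neg hc] at hfx
        exact absurd hfx (by simp)
      exact hcond y (hvx.symm.trans (SimpleGraph.ConnectedComponent.exact hy).symm)
    · intro h
      have hf : ∀ x, H.Reachable v x → f x = 1 := by
        intro x hx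
        refine if_pos fun y hy => h x (SimpleGraph.ConnectedComponent.sound hx).symm y
          (SimpleGraph.ConnectedComponent.sound (hx.trans hy)).symm
      exact Aggregation.fragmentInf_eq (SimpleGraph.Reachable.refl v)
        (hf v (SimpleGraph.Reachable.refl v)) fun y hy => (hf y hy).ge
  refine ⟨fun v => (Aggregation.outcomeAfter H (fun v => (net.ident v : WithTop ℕ)) D v).isSome, ?_⟩
  simp only [Option.some.injEq, hinf] at h2
  exact h2.mono (by omega)

/-- The effect of the first part of a phase, at the end of which every active fragment has chosen a
minimum weight outgoing edge. -/
theorem runs_select (hT : net.IsUniqueMST T) (hHT : H ≤ T)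
    (hL : ∀ F : H.ConnectedComponent, FragmentDiamLE H F L) (hid : ∀ v, net.ident v < N)
    (hσ : net.ForestState H σ) (hN : 1 ≤ N) :
    ∃ (τ : net.Config Memory) (src dst : H.ConnectedComponent → V) (col : H.ConnectedComponent → ℕ),
      net.Runs (net.SmallMessage N) (Schedule.identify L ++ Schedule.probe L (2 ^ i) ++
        [Schedule.announce] ++ Schedule.choose L ++ [Schedule.mark]) (withBuffer σ) (withBuffer τ)
        (2 * net.graph.edgeSet.ncard + 9 * Fintype.card V) ∧
      (∀ F, net.IsActive i F → net.IsMWOE F (src F) (dst F)) ∧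
      net.MatchingState i H src dst col (fun F => ¬ net.IsActive i F) (fun _ => False) τ ∧
      (∀ F, col F < N) ∧ Function.Injective col := by
  classical
  let c : V → H.ConnectedComponent := H.connectedComponentMk
  have hc : ∀ {v w}, c v = c w ↔ H.Reachable v w := SimpleGraph.ConnectedComponent.eq
  have hout : ∀ F : H.ConnectedComponent, c (Quot.out F) = F := fun F => Quot.out_eq F
  let fid := net.fragmentIdent H
  have hfid : ∀ {v w}, fid v = fid w ↔ c v = c w := fragmentIdent_eq_iff.trans hc.symm
  let f : V → WithTop (ℝ ×ₗ ℕ) := fun v => (Finset.univ.filter fun j => c (net.port v j) ≠ c v).inf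
    fun j => ((toLex (net.weight s(v, net.port v j), net.ident v) : ℝ ×ₗ ℕ) : WithTop (ℝ ×ₗ ℕ))
  obtain ⟨o, hodef⟩ : ∃ o : V → WithTop (ℝ ×ₗ ℕ), ∀ v, Aggregation.fragmentInf H f v = o v :=
    ⟨_, fun _ => rfl⟩
  have hf : ∀ v, f v ≠ ⊤ → ∃ j, c (net.port v j) ≠ c v ∧
      f v = ((toLex (net.weight s(v, net.port v j), net.ident v) : ℝ ×ₗ ℕ) :
        WithTop (ℝ ×ₗ ℕ)) := by
    intro v hv
    have hne : (Finset.univ.filter fun j => c (net.port v j) ≠ c v).Nonempty := by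
      rw [Finset.nonempty_iff_ne_empty]
      intro he
      apply hv
      simp only [f]
      rw [he, Finset.inf_empty]
    obtain ⟨j, hj, he⟩ := Finset.exists_mem_eq_inf _ hne (fun j =>
      ((toLex (net.weight s(v, net.port v j), net.ident v) : ℝ ×ₗ ℕ) : WithTop (ℝ ×ₗ ℕ)))
    exact ⟨j, (Finset.mem_filter.1 hj).2, he⟩
  have hfle : ∀ {v u}, net.graph.Adj v u → c u ≠ c v →
      f v ≤ ((toLex (net.weight s(v, u), net.ident v) : ℝ ×ₗ ℕ) : WithTop (ℝ ×ₗ ℕ)) := by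
    intro v u huv hne
    have hp : (net.port v ((net.port v).symm ⟨u, huv⟩) : V) = u := by rw [Equiv.apply_symm_apply]
    have h := Finset.inf_le (s := Finset.univ.filter fun j => c (net.port v j) ≠ c v)
      (f := fun j => ((toLex (net.weight s(v, net.port v j), net.ident v) : ℝ ×ₗ ℕ) :
        WithTop (ℝ ×ₗ ℕ))) (b := (net.port v).symm ⟨u, huv⟩)
      (Finset.mem_filter.2 ⟨Finset.mem_univ _, by rwa [hp]⟩)
    rwa [hp] at h
  have hole : ∀ {v w}, c v = c w → o v ≤ f w := fun h => by
    rw [← hodef]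
    exact Aggregation.fragmentInf_le (hc.1 h)
  have hocongr : ∀ {v w}, c v = c w → o v = o w := fun h => by
    rw [← hodef, ← hodef, Aggregation.fragmentInf_congr (hc.1 h)]
  have hotop : ∀ v, o v ≠ ⊤ ↔ ∃ u w, net.IsOutgoing (c v) u w := by
    intro v
    constructor
    · intro h
      obtain ⟨w, hw, he⟩ := Aggregation.exists_fragmentInf_eq H f v
      rw [hodef] at he
      obtain ⟨j, hj, -⟩ := hf w (he ▸ h)
      have hw' : c w = c v := (hc.2 hw).symm
      exact ⟨w, net.port w j, hw', fun h => hj (hw' ▸ h), (net.port w j).2⟩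
    · rintro ⟨u, w, hu, hw, hadj⟩ h
      have h1 : c u = c v := hu
      have h2 := (hole h1.symm).trans (hfle hadj fun h => hw (h.trans h1))
      rw [h, top_le_iff] at h2
      exact WithTop.coe_ne_top h2
  let Cand : ∀ v, Fin (net.deg v) → Prop := fun v j => fid (net.port v j) ≠ fid v ∧
    some (o v) = some ((toLex (net.weight s(v, net.port v j), net.ident v) : ℝ ×ₗ ℕ) :
      WithTop (ℝ ×ₗ ℕ))
  have hact : ∀ v, (FragmentDiamLE H (c v) (2 ^ i) ∧ some (o v) ≠ some ⊤) ↔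
      net.IsActive i (c v) := by
    intro v
    rw [ne_eq, Option.some.injEq, ← ne_eq, hotop]
    rfl
  have hsel : ∀ F, ∃ s d, net.IsActive i F → net.IsMWOE F s d ∧
      ∀ v j, c v = F → (FirstPort (Cand v) j ↔ v = s ∧ (net.port v j : V) = d) := by
    intro F
    by_cases hF : net.IsActive i F
    swap
    · exact ⟨Quot.out F, Quot.out F, fun h => absurd h hF⟩
    have hotopF := (hotop (Quot.out F)).2 (by rw [hout]; exact hF.2)
    obtain ⟨w, hw, he⟩ := Aggregation.exists_fragmentInf_eq H f (Quot.out F)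
    have hwF : c w = F := (hc.2 hw).symm.trans (hout F)
    rw [hodef] at he
    obtain ⟨l, hl, hl'⟩ := hf w (he ▸ hotopF)
    have how : o w = f w := (hocongr (hwF.trans (hout F).symm)).trans he
    obtain ⟨j, hj⟩ := exists_firstPort (P := Cand w)
      ⟨l, fun h => hl (hfid.1 h), by rw [how, hl']⟩
    have hjo : o w = ((toLex (net.weight s(w, net.port w j), net.ident w) : ℝ ×ₗ ℕ) :
        WithTop (ℝ ×ₗ ℕ)) := Option.some.inj hj.1.2
    refine ⟨w, net.port w j, fun _ => ⟨⟨⟨hwF, fun h => ?_, (net.port w j).2⟩, ?_⟩, ?_⟩⟩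
    · exact hj.1.1 (hfid.2 ((show c (net.port w j) = F from h).trans hwF.symm))
    · rintro u u' ⟨hu, hu', hadj⟩
      have h1 : c u = F := hu
      have h2 := (hole (hwF.trans h1.symm)).trans (hfle hadj fun h => hu' (h.trans h1))
      rw [hjo, WithTop.coe_le_coe, Prod.Lex.toLex_le_toLex] at h2
      rcases h2 with h2 | h2
      · exact h2.le
      · exact h2.1.le
    · intro v l hv
      constructor
      · intro h
        have h1 := Option.some.inj h.1.2
        rw [hocongr (hv.trans hwF.symm), hjo] at h1
        have h2 : v = w := net.ident_injective
          (congrArg Prod.snd (toLex.injective (WithTop.coe_injective h1))).symm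
        subst h2
        rw [h.unique hj]
        exact ⟨rfl, rfl⟩
      · rintro ⟨rfl, h⟩
        rwa [(net.port v).injective (Subtype.ext h)]
  -- Only the vertex whose identity number occurs in the minimum finds a candidate port.
  choose src dst hsd using hsel
  have hmw : ∀ F, net.IsActive i F → net.IsMWOE F (src F) (dst F) := fun F hF => (hsd F hF).1
  have houtiff : ∀ v j, ((FragmentDiamLE H (c v) (2 ^ i)) ∧ FirstPort (Cand v) j) ↔
      net.ChosenEdge i H src dst v (net.port v j) := by
    intro v j
    constructor
    · rintro ⟨h1, h2⟩
      have hF : net.IsActive i (c v) := by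
        refine (hact v).1 ⟨h1, ?_⟩
        rw [h2.1.2]
        exact fun h => WithTop.coe_ne_top (Option.some.inj h)
      exact ⟨hF, ((hsd _ hF).2 v j rfl).1 h2⟩
    · rintro ⟨h1, h2⟩
      exact ⟨h1.1, ((hsd _ h1).2 v j rfl).2 h2⟩
  have h1 := runs_identify hT hHT hL hid hσ
  obtain ⟨small, h2⟩ := runs_probe (σ := fun v => { σ v with fid := net.fragmentIdent H v }) hT hHT
    hL hid ⟨hσ.ident, hσ.weight, hσ.tree⟩ (2 ^ i) hN
  have hfidN : ∀ v, fid v < N := fun v => by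
    obtain ⟨w, -, hw⟩ := net.exists_fragmentIdent_eq H v
    exact (show fid v = net.ident w from hw) ▸ hid w
  have h3 := (h1.append h2).append (runs_exchange (good := net.SmallMessage N)
    (send := fun x _ => some (numMessage x.fid))
    (recv := fun x m => { x with nfid := fun i => (m i).elim 0 fun m => m.nums.headD 0 })
    (fun v _ => some (numMessage (fid v))) (M := 2 * net.graph.edgeSet.ncard)
    (fun v j => rfl) (net.sum_ports_le_edges fun v _ => (some (numMessage (fid v))).isSome = true)
    (fun v u m hm => by
      rw [← Option.some.inj hm]
      refine smallMessage_num ?_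
      have := hfidN v
      omega))
  have h4 := h3.append (Aggregation.runs_steps
    (a := (⟨fun x => x.tree, Schedule.bestEdge⟩ : Aggregation Memory (WithTop (ℝ ×ₗ ℕ))))
    (good := net.SmallMessage N) hT.1.1.2 hHT (hHT.trans hT.1.1.1)
    (by exact hσ.tree) f
    (by
      intro v
      simp only [Schedule.bestEdge, f, hσ.weight, hσ.ident]
      congr 1
      ext j
      simp only [Finset.mem_filter, Finset.mem_univ, true_and]
      exact not_congr hfid)
    (by
      intro v
      by_cases hv : f v = ⊤
      · rw [hv]
        exact smallMessage_token
      · obtain ⟨j, -, hj⟩ := hf v hv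
        rw [hj]
        have hb := hid v
        refine ⟨le_rfl, ?_, le_rfl, ?_⟩
        · intro x hx
          have : x = net.ident v := List.mem_singleton.1 hx
          omega
        · intro x hx
          exact ⟨s(v, net.port v j), (net.port v j).2, (List.mem_singleton.1 hx).symm⟩)
    L fun x o => { x with
      active := decide (x.active = true ∧ o ≠ some ⊤)
      out := fun j => decide (x.active = true ∧ FirstPort (fun i => x.nfid i ≠ x.fid ∧
        o = some ((toLex (x.weight i, x.ident) : ℝ ×ₗ ℕ) : WithTop (ℝ ×ₗ ℕ))) j)
      color := x.fid
      matched := decide (¬ (x.active = true ∧ o ≠ some ⊤))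
      accepted := false })
  simp only [Aggregation.outcomeAfter_of_diam hL, hodef, decide_eq_true_iff, hσ.weight, hσ.ident]
    at h4
  have h5 := h4.append (runs_exchange_if (good := net.SmallMessage N)
    (send := fun x i => if x.out i then some token else none)
    (recv := fun x m => { x with inn := fun i => (m i).isSome })
    (net.ChosenEdge i H src dst) (fun _ => token)
    (fun v j => by
      rw [← houtiff v j]
      simp only [decide_eq_true_iff]
      exact ⟨fun h => if_pos h, fun h => if_neg h⟩)
    (Or.inl fun v u u' h h' => h.right_unique h')
    (fun v u _ => smallMessage_token))
  refine ⟨_, src, dst, fun F => fid (Quot.out F), h5.mono (by omega), hmw,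
    ⟨⟨fun _ => rfl, hσ.weight, hσ.tree⟩, fun v j => ?_, fun v j => ?_, fun v => ?_,
      fun v => ?_, fun v => ?_⟩, fun F => hfidN _, fun F F' h => ?_⟩
  · rw [← houtiff v j]
    exact decide_eq_true_iff
  · dsimp only
    split_ifs with h <;> simp [h]
  · exact hfid.2 (hout (c v)).symm
  · exact decide_eq_true_iff.trans (not_congr (hact v))
  · simp
  · rw [← hout F, ← hout F']
    exact hfid.1 h

theorem colorBound_le (hN : 2 ≤ N) (j : ℕ) : colorBound N j ≤ 4 * N :=
  Nat.mul_le_mul_left 4 (max_le (iterate_clog_le N j) hN)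

/-- The effect of a phase. -/
theorem runs_phase (hT : net.IsUniqueMST T) (hHT : H ≤ T)
    (hL : ∀ F : H.ConnectedComponent, FragmentDiamLE H F (6 * 2 ^ i))
    (hid : ∀ v, net.ident v < N) (hσ : net.ForestState H σ) (hN : 2 ≤ N) :
    ∃ (τ : net.Config Memory) (H' : SimpleGraph V),
      net.Runs (net.SmallMessage N) (Schedule.phase (logStar N) i) (withBuffer σ) (withBuffer τ)
        (2 * net.graph.edgeSet.ncard + (58 + 3 * logStar N) * Fintype.card V) ∧
      net.ForestState H' τ ∧ net.IsPhase i H H' := by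
  obtain ⟨σ₁, src, dst, col₀, hr₁, hmw, hm₁, hlt, hinj⟩ :=
    runs_select (i := i) hT hHT hL hid hσ (one_le_two.trans hN)
  have htgt : ∀ F, net.IsActive i F → F ≠ H.connectedComponentMk (dst F) :=
    fun F hF he => (hmw F hF).1.2.1 he.symm
  -- The identity numbers of the fragments are the first colours, and recolouring keeps colours
  -- different along the chosen edges.
  obtain ⟨x₂, hr₂, σ₂, rfl, col, hm₂, hcol, hproper⟩ := Runs.repeat
    (net := net) (good := net.SmallMessage N) (M := 3 * Fintype.card V)
    (b := fun _ => Schedule.tossCoins (6 * 2 ^ i)) (σ := withBuffer σ₁)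
    (I := fun j x => ∃ σ, x = withBuffer σ ∧ ∃ col,
      net.MatchingState i H src dst col (fun F => ¬ net.IsActive i F) (fun _ => False) σ ∧
      (∀ F, col F < colorBound N j) ∧
      ∀ F, net.IsActive i F → col F ≠ col (H.connectedComponentMk (dst F)))
    (by
      rintro j _ ⟨σ, rfl, col, hm, hcol, hproper⟩
      obtain ⟨τ, hr, hm'⟩ := runs_tossCoins (N := N) hT hHT hL hmw hm
        fun F => (hcol F).le.trans (colorBound_le hN j)
      refine ⟨_, hr, τ, rfl, _, hm', fun F => ?_, fun F hF => ?_⟩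
      · refine lt_of_lt_of_le ?_ (two_mul_clog_colorBound_le N j)
        unfold newColor
        split_ifs
        · exact recolor_lt (two_le_colorBound N j) (hcol _) (hcol _)
        · exact recolorRoot_lt (two_le_colorBound N j)
      · unfold newColor
        rw [if_pos hF]
        split_ifs with hF'
        · exact recolor_ne_recolor (hproper F hF) (hproper _ hF')
        · exact recolor_ne_recolorRoot (hproper F hF))
    ⟨σ₁, rfl, col₀, hm₁, fun F => (hlt F).trans_le (by
      unfold colorBound
      simp only [Function.iterate_zero, id]
      omega), fun F hF h => htgt F hF (hinj h)⟩ (logStar N)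
  have hcol8 : ∀ F, col F < 8 := by
    intro F
    have h1 := hcol F
    have h2 := iterate_logStar_le_one N
    unfold colorBound at h1
    omega
  -- Colours are below `8`, so eight rounds of proposals treat all chosen edges.
  obtain ⟨x₃, hr₃, σ₃, rfl, mat, add, hm₃, hg⟩ := Runs.repeat
    (net := net) (good := net.SmallMessage N) (M := 6 * Fintype.card V)
    (b := fun a => Schedule.propose (6 * 2 ^ i) a) (σ := withBuffer σ₂)
    (I := fun a x => ∃ σ, x = withBuffer σ ∧ ∃ mat add,
      net.MatchingState i H src dst col mat add σ ∧
      IsGreedyMatching (net.IsActive i) (fun F => H.connectedComponentMk (dst F)) col a mat add)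
    (by
      rintro a _ ⟨σ, rfl, mat, add, hm, hg⟩
      obtain ⟨τ, A, hr, hm', h1, h2, h3⟩ := runs_propose hT hHT hL hid hmw hm a
      exact ⟨_, hr, τ, rfl, _, _, hm', hg.step hproper h1 h2 h3⟩)
    ⟨σ₂, rfl, _, _, hm₂, ⟨fun F hF => hF, fun F h => h.elim, fun F h h' => absurd h h',
      fun F F' h => h.elim, fun F F' h => h.elim, fun F _ h => absurd h (Nat.not_lt_zero _)⟩⟩ 8
  obtain ⟨τ, hr₄, hτ⟩ := runs_merge (N := N) hmw hm₃
  refine ⟨τ, _, (((hr₁.append hr₂).append hr₃).append hr₄).mono (le_of_eq (by ring)), hτ,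
    isPhase_mergedForest hT hHT hmw hg hcol8⟩

end Network

/-! ### The whole algorithm -/

namespace Schedule

/-- The schedule of the algorithm. No messages are sent for `k ≤ 1`. -/
noncomputable def program (N k : ℕ) : List Round :=
  if k ≤ 1 then [] else
    (List.range (Nat.clog 2 k + 1)).flatMap (phase (logStar N)) ++
      identify (6 * 2 ^ (Nat.clog 2 k + 1))

/-- The memory of a vertex at the beginning, when it forms a fragment of its own. -/
def initialMemory {d : ℕ} (ident : ℕ) (weight : Fin d → ℝ) : Memory d where
  ident := ident
  weight := weight
  tree _ := false
  fid := ident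
  nfid _ := 0
  small := false
  active := false
  out _ := false
  inn _ := false
  color := 0
  matched := false
  accepted := false
  report := ⊤
  proposed _ := false
  accepting _ := false

theorem length_flatMap_phase_le (s t : ℕ) :
    ((List.range t).flatMap (phase s)).length ≤ (154 + 8 * s) * 2 ^ t := by
  induction t with
  | zero => simp
  | succ t ih =>
    rw [List.range_succ, List.flatMap_append, List.flatMap_singleton, List.length_append, pow_succ]
    have := length_phase_le s t
    linarith

theorem length_program_le {N k : ℕ} (hk : 1 ≤ k) :
    (program N k).length ≤ (161 + 8 * logStar N) * (4 * k) := by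
  unfold program
  split_ifs with h
  · exact Nat.zero_le _
  · have h1 := length_flatMap_phase_le (logStar N) (Nat.clog 2 k + 1)
    have h2 := two_pow_clog_le hk
    have h3 : 1 ≤ 2 ^ Nat.clog 2 k := Nat.one_le_two_pow
    rw [List.length_append, identify, Aggregation.length_steps]
    rw [pow_succ] at h1 ⊢
    have h4 := Nat.mul_le_mul_left (161 + 8 * logStar N)
      (show 2 ^ Nat.clog 2 k * 2 ≤ 4 * k by omega)
    linarith

end Schedule

/-- The distributed Controlled-GHS algorithm. It does not depend on the network or on the exponent that
bounds the identity numbers. -/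
noncomputable def controlledGHS : Protocol :=
  scheduledProtocol Schedule.program
    (fun ident weight => (Schedule.initialMemory ident weight, Buffer.empty))
    fun s => ⟨s.1.tree, s.1.fid⟩

namespace Network

variable {V : Type*} {net : Network V} {N k : ℕ} {T H H' : SimpleGraph V}

theorem IsPhaseResult.succ {t : ℕ} (h : net.IsPhaseResult t H) (h' : net.IsPhase t H H') :
    net.IsPhaseResult (t + 1) H' := by
  obtain ⟨Hs, h0, hs, rfl⟩ := h
  refine ⟨fun j => if j ≤ t then Hs j else H', by simpa using h0, fun j hj => ?_, by simp⟩
  rcases Nat.lt_succ_iff_lt_or_eq.1 hj with hj | rfl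
  · simpa only [hj.le, if_true, Nat.succ_le_iff.2 hj] using hs j hj
  · simpa using h'

theorem fragmentDiamLE_bot (F : (⊥ : SimpleGraph V).ConnectedComponent) (d : ℕ) :
    FragmentDiamLE ⊥ F d := fun u _ v _ => by
  rw [SimpleGraph.dist_bot]
  exact Nat.zero_le d

theorem fragmentSizeGE_one [Finite V] (H : SimpleGraph V) : FragmentSizeGE H 1 := fun v =>
  Or.inl ((Set.ncard_pos (Set.toFinite _)).2 ⟨v, SimpleGraph.Reachable.refl v⟩)

/-- The configuration at the beginning. -/
def initialConfig (net : Network V) : net.Config Memory :=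
  fun v => Schedule.initialMemory (net.ident v) fun j => net.weight s(v, net.port v j)

theorem forestState_initialConfig : net.ForestState ⊥ net.initialConfig :=
  ⟨fun _ => rfl, fun _ _ => rfl, fun v j => by simp [initialConfig, Schedule.initialMemory]⟩

theorem SmallMessage.bits_le {n c : ℕ} {m : Message} (h : net.SmallMessage N m) (hn : 2 ≤ n)
    (hN : N ≤ n ^ c) : (m.bits : ℝ) ≤ (2 * c + 4 : ℕ) * Real.logb 2 n := by
  have hlog : 1 ≤ Real.logb 2 n := by
    rw [Real.le_logb_iff_rpow_le one_lt_two (by positivity), Real.rpow_one]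
    exact_mod_cast hn
  have h1 : m.bits ≤ c * Nat.clog 2 n + 4 := by
    obtain ⟨nums, weights⟩ := m
    obtain ⟨h1, h2, -⟩ := h
    match nums, h1, h2 with
    | [], _, _ => exact Nat.zero_le _
    | [x], _, h2 =>
      have hx : x ≤ 4 * N := h2 x (List.mem_singleton.2 rfl)
      have hs : x.size ≤ c * Nat.clog 2 n + 3 := by
        rw [Nat.size_le, pow_add, mul_comm c, pow_mul]
        have h3 : n ^ c ≤ (2 ^ Nat.clog 2 n) ^ c :=
          Nat.pow_le_pow_left (Nat.le_pow_clog one_lt_two n) c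
        have h4 : 1 ≤ (2 ^ Nat.clog 2 n) ^ c := Nat.one_le_pow _ _ (Nat.two_pow_pos _)
        omega
      simpa [Message.bits] using hs
  have h2 := clog_le_logb_add_one (one_le_two.trans hn)
  have h3 : (m.bits : ℝ) ≤ c * Nat.clog 2 n + 4 := by exact_mod_cast h1
  have h4 : (c : ℝ) * Nat.clog 2 n ≤ c * (2 * Real.logb 2 n) :=
    mul_le_mul_of_nonneg_left (by linarith) (Nat.cast_nonneg c)
  push_cast
  linarith

variable [Fintype V]

/-- The bounds for the sizes and the diameters of the fragments double in every phase. After `t`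
phases the size is only known to be at least `2 ^ (t - 1)`, since a fragment that is inactive because
of its diameter may have hardly more vertices than that. -/
theorem runs_phases (hT : net.IsUniqueMST T) (hid : ∀ v, net.ident v < N) (hN : 2 ≤ N) (t : ℕ) :
    ∃ (τ : net.Config Memory) (H : SimpleGraph V),
      net.Runs (net.SmallMessage N) ((List.range t).flatMap (Schedule.phase (logStar N)))
        (withBuffer net.initialConfig) (withBuffer τ)
        (t * (2 * net.graph.edgeSet.ncard + (58 + 3 * logStar N) * Fintype.card V)) ∧
      net.ForestState H τ ∧ H ≤ T ∧ (∀ F : H.ConnectedComponent, FragmentDiamLE H F (6 * 2 ^ t)) ∧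
      FragmentSizeGE H (2 ^ (t - 1)) ∧ net.IsPhaseResult t H := by
  -- The truncated subtraction is meant: after `0` phases the size is at least `2 ^ 0`.
  have hconn : net.graph.Connected := hT.1.1.2.connected.mono hT.1.1.1
  obtain ⟨x, hr, τ, rfl, H, h⟩ := Runs.repeat (net := net) (good := net.SmallMessage N)
    (M := 2 * net.graph.edgeSet.ncard + (58 + 3 * logStar N) * Fintype.card V)
    (b := Schedule.phase (logStar N)) (σ := withBuffer net.initialConfig)
    (I := fun i x => ∃ σ, x = withBuffer σ ∧ ∃ H : SimpleGraph V,
      net.ForestState H σ ∧ H ≤ T ∧ (∀ F : H.ConnectedComponent, FragmentDiamLE H F (6 * 2 ^ i)) ∧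
      FragmentSizeGE H (2 ^ (i - 1)) ∧ net.IsPhaseResult i H)
    (by
      rintro i _ ⟨σ, rfl, H, hσ, hHT, hL, hS, hP⟩
      obtain ⟨τ, H', hr, hτ, hph⟩ := runs_phase hT hHT hL hid hσ hN
      refine ⟨_, hr, τ, rfl, H', hτ, hph.le_tree hT hHT, fun F => (hph.diam hL F).mono ?_,
        hph.size hconn ?_ hS, hP.succ hph⟩
      · have h1 : 1 ≤ 2 ^ i := Nat.one_le_two_pow
        rw [pow_succ]
        omega
      · rw [← pow_succ']
        exact Nat.pow_le_pow_right two_pos (by omega))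
    ⟨_, rfl, ⊥, forestState_initialConfig, bot_le, fun F => fragmentDiamLE_bot F _,
      fragmentSizeGE_one _, fun _ => ⊥, rfl, fun j hj => absurd hj (Nat.not_lt_zero j), rfl⟩ t
  exact ⟨τ, H, hr, h⟩

/-- The effect of the whole schedule. -/
theorem runs_program (hT : net.IsUniqueMST T) (hid : ∀ v, net.ident v < N) (hN : 2 ≤ N)
    (hk : 1 ≤ k) (hkn : k ≤ Fintype.card V) :
    ∃ (τ : net.Config Memory) (t : ℕ) (H : SimpleGraph V),
      net.Runs (net.SmallMessage N) (Schedule.program N k)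
        (withBuffer net.initialConfig) (withBuffer τ)
        (if k = 1 then 0 else (Nat.clog 2 k + 1) * (2 * net.graph.edgeSet.ncard +
          (58 + 3 * logStar N) * Fintype.card V) + 2 * Fintype.card V) ∧
      net.ForestState H τ ∧ (∀ v, (τ v).fid = net.fragmentIdent H v) ∧ H ≤ T ∧
      (∀ F : H.ConnectedComponent, FragmentDiamLE H F (24 * k)) ∧
      FragmentSizeGE H k ∧ net.IsPhaseResult t H ∧ t ≤ Nat.clog 2 k + 1 := by
  rcases Nat.eq_or_lt_of_le hk with rfl | hk'
  · refine ⟨net.initialConfig, 0, ⊥, ?_, forestState_initialConfig, fun v => ?_, bot_le,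
      fun F => fragmentDiamLE_bot F _, fragmentSizeGE_one _,
      ⟨fun _ => ⊥, rfl, fun j hj => absurd hj (Nat.not_lt_zero j), rfl⟩, Nat.zero_le _⟩
    · simpa [Schedule.program] using Runs.nil
    · obtain ⟨w, hw, he⟩ := net.exists_fragmentIdent_eq ⊥ v
      rw [he, ← SimpleGraph.reachable_bot.1 hw]
      rfl
  · obtain ⟨σ, H, hr, hσ, hHT, hL, hS, hP⟩ := runs_phases hT hid hN (Nat.clog 2 k + 1)
    have h1 := two_pow_clog_le hk
    have h2 := Nat.le_pow_clog one_lt_two k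
    have h3 := hr.append (runs_identify hT hHT hL hid hσ)
    rw [Schedule.program, if_neg (not_le.2 hk'), if_neg hk'.ne']
    refine ⟨_, _, H, h3, ⟨hσ.ident, hσ.weight, hσ.tree⟩, fun v => rfl, hHT,
      fun F => (hL F).mono ?_, fun v => (hS v).imp (fun h => h2.trans h) id, hP, le_rfl⟩
    rw [pow_succ]
    omega

end Network

theorem theorem3 (c : ℕ) :
    ∃ (C : ℕ) (P : Protocol),
      ∀ (V : Type*) [Fintype V] (net : Network V) (T : SimpleGraph V) (N k : ℕ),
        net.IsUniqueMST T →
        (∀ v, net.ident v < N) → N ≤ Fintype.card V ^ c →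
        1 ≤ k → (k : ℝ) ≤ (Fintype.card V : ℝ) / 10 →
        ∃ (R t : ℕ) (H : SimpleGraph V),
          P.HaltsWithin net N k R ∧
          P.Computes net N k R H ∧
          IsMSTForest T H ((Fintype.card V : ℝ) / k) (C * k) ∧
          net.IsPhaseResult t H ∧ t ≤ ⌈Real.logb 2 k⌉₊ + C ∧
          R ≤ C * (k * logStar (Fintype.card V)) ∧
          (P.messageCount net N k R : ℝ) ≤
            C * (net.graph.edgeSet.ncard * Real.logb 2 k +
              Fintype.card V * Real.logb 2 k * logStar (Fintype.card V)) ∧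
          P.HasBandwidth net N k (C * Real.logb 2 (Fintype.card V)) C := by
  refine ⟨700 + 40 * logStar (2 ^ c) + 2 * c, controlledGHS, ?_⟩
  intro V _ net T N k hT hid hN hk hkn
  set n := Fintype.card V with hn
  set C := 700 + 40 * logStar (2 ^ c) + 2 * c with hC
  have hn10 : 10 * k ≤ n := by
    have : (10 * k : ℝ) ≤ n := by linarith
    exact_mod_cast this
  have hn2 : 2 ≤ n := by omega
  -- The identity numbers are distinct, so `N` is at least the number of vertices.
  have hnN : n ≤ N := by
    have := Finset.card_le_card_of_injOn (s := (Finset.univ : Finset V)) (t := Finset.range N)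
      net.ident (fun v _ => Finset.mem_coe.2 (Finset.mem_range.2 (hid v)))
      net.ident_injective.injOn
    rwa [Finset.card_range, Finset.card_univ] at this
  obtain ⟨τ, t, H, hr, hτ, hfid, hHT, hL, hS, hP, ht⟩ :=
    Network.runs_program (k := k) hT hid (hn2.trans hnN) hk (by omega)
  have h0 : controlledGHS.run net N k 0
      = fun v => (Schedule.program N k, withBuffer net.initialConfig v) := rfl
  have hrun : controlledGHS.run net N k (Schedule.program N k).length
      = fun v => ([], withBuffer τ v) := by
    have h1 := run_add_length _ h0
    rwa [hr.exec_eq, Nat.zero_add] at h1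
  have hs1 := logStar_pos hn2
  have hs2 := logStar_le_add hn2 hN
  have hs : logStar N ≤ (1 + logStar (2 ^ c)) * logStar n := by
    rw [add_mul, one_mul]
    exact hs2.trans (Nat.add_le_add_left (Nat.le_mul_of_pos_right _ hs1) _)
  refine ⟨(Schedule.program N k).length, t, H, ?_, ?_, ⟨hHT, ?_, ?_⟩, hP, ?_, ?_, ?_, ?_⟩
  · intro v
    rw [hrun]
    rfl
  · refine ⟨fun v => ⟨(τ v).tree, (τ v).fid⟩, fun v => ?_, hτ.tree, fun F => ?_⟩
    · rw [hrun]
      rfl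
    · induction F using SimpleGraph.ConnectedComponent.ind with | _ v
      obtain ⟨w, hw, he⟩ := net.exists_fragmentIdent_eq H v
      refine ⟨w, SimpleGraph.ConnectedComponent.sound hw.symm, fun u hu => ?_⟩
      dsimp only
      rw [hfid, ← he]
      exact Network.fragmentIdent_eq_iff.2 (SimpleGraph.ConnectedComponent.exact hu)
  · have h1 := mul_card_connectedComponent_le hS (by omega)
    rw [le_div_iff₀ (by exact_mod_cast hk), mul_comm]
    exact_mod_cast h1
  · exact fun F => (hL F).mono (Nat.mul_le_mul_right k (by omega : 24 ≤ C))
  · have h1 := Real.natCeil_logb_natCast 2 k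
    rw [Nat.cast_ofNat] at h1
    rw [h1]
    omega
  · refine (Schedule.length_program_le hk).trans ?_
    have h1 : 161 + 8 * logStar N ≤ (169 + 8 * logStar (2 ^ c)) * logStar n := by
      calc 161 + 8 * logStar N
          ≤ 161 * logStar n + 8 * ((1 + logStar (2 ^ c)) * logStar n) :=
            add_le_add (Nat.le_mul_of_pos_right _ hs1) (Nat.mul_le_mul_left 8 hs)
        _ = _ := by ring
    calc (161 + 8 * logStar N) * (4 * k)
        ≤ (169 + 8 * logStar (2 ^ c)) * logStar n * (4 * k) := Nat.mul_le_mul_right _ h1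
      _ = (676 + 32 * logStar (2 ^ c)) * (k * logStar n) := by ring
      _ ≤ C * (k * logStar n) := Nat.mul_le_mul_right _ (by omega)
  · have hcount : controlledGHS.messageCount net N k (Schedule.program N k).length
        = net.cost (Schedule.program N k) (withBuffer net.initialConfig) := by
      rw [← messageCount_add_length _ h0]
      simp only [Nat.zero_add]
      rfl
    have h1 := hr.cost_le
    rw [← hcount] at h1
    by_cases hk1 : k = 1
    · rw [if_pos hk1] at h1
      rw [Nat.le_zero.1 h1, hk1]
      simp
    rw [if_neg hk1] at h1
    have hk2 : 2 ≤ k := by omega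
    have hlog : 1 ≤ Real.logb 2 k := by
      rw [Real.le_logb_iff_rpow_le one_lt_two (by positivity), Real.rpow_one]
      exact_mod_cast hk2
    have ht : (Nat.clog 2 k : ℝ) + 1 ≤ 3 * Real.logb 2 k := by
      have := clog_le_logb_add_one hk
      linarith
    have h2 : (controlledGHS.messageCount net N k (Schedule.program N k).length : ℝ)
        ≤ (Nat.clog 2 k + 1) * (2 * net.graph.edgeSet.ncard + (58 + 3 * logStar N) * n) + 2 * n := by
      exact_mod_cast h1
    have hs' : (logStar N : ℝ) ≤ (1 + logStar (2 ^ c)) * logStar n := by exact_mod_cast hs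
    have hs1' : (1 : ℝ) ≤ logStar n := by exact_mod_cast hs1
    set E : ℝ := ((net.graph.edgeSet.ncard : ℕ) : ℝ)
    set l := Real.logb 2 k
    set s : ℝ := ((logStar n : ℕ) : ℝ)
    set q : ℝ := ((logStar (2 ^ c) : ℕ) : ℝ)
    have hq : 0 ≤ q := Nat.cast_nonneg _
    have hE : 0 ≤ E := Nat.cast_nonneg _
    have hn0 : (0 : ℝ) ≤ n := Nat.cast_nonneg _
    have h3 : (58 + 3 * (logStar N : ℝ)) * n ≤ (61 + 3 * q) * s * n := by
      apply mul_le_mul_of_nonneg_right _ hn0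
      nlinarith
    have h4 : ((Nat.clog 2 k : ℝ) + 1) * (2 * E + (58 + 3 * logStar N) * n)
        ≤ 3 * l * (2 * E + (61 + 3 * q) * s * n) :=
      mul_le_mul ht (by linarith) (by positivity) (by linarith)
    have h5 : 2 * (n : ℝ) ≤ 2 * (n * l * s) := by
      have : 1 ≤ l * s := one_le_mul_of_one_le_of_one_le hlog hs1'
      nlinarith
    have hEl : 0 ≤ E * l := mul_nonneg hE (by linarith)
    have hnls : 0 ≤ n * l * s := mul_nonneg (mul_nonneg hn0 (by linarith)) (by linarith)
    have hCq : (C : ℝ) = 700 + 40 * q + 2 * c := by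
      rw [hC]
      push_cast
      rfl
    have hc0 : (0 : ℝ) ≤ c := Nat.cast_nonneg c
    calc _ ≤ 3 * l * (2 * E + (61 + 3 * q) * s * n) + 2 * (n * l * s) := by linarith
      _ = 6 * (E * l) + (185 + 9 * q) * (n * l * s) := by ring
      _ ≤ C * (E * l) + C * (n * l * s) :=
        add_le_add (mul_le_mul_of_nonneg_right (by linarith) hEl)
          (mul_le_mul_of_nonneg_right (by linarith) hnls)
      _ = _ := by ring
  · intro r v j m hm
    rw [← Nat.zero_add r] at hm
    have hsm := good_of_sent _ h0 hr.allMessages r v j m hm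
    refine ⟨(hsm.bits_le hn2 hN).trans ?_, hsm.2.2.1.trans (by omega), hsm.2.2.2⟩
    refine mul_le_mul_of_nonneg_right ?_ (Real.logb_nonneg one_lt_two ?_)
    · exact_mod_cast (by omega : 2 * c + 4 ≤ C)
    · exact_mod_cast one_le_two.trans hn2
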